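/- Let $r\ge 1$ and let $(X_1,d_1),\dots,(X_r,d_r)$ be locally compact Hadamard spaces (complete geodesic metric spaces all of whose geodesic triangles satisfy the CAT(0) inequality), and let $X=X_1\times\cdots\times X_r$ carry the product distance $d=\sqrt{d_1^2+\cdots+d_r^2}$. An isometry $\varphi$ of $X_i$ is called axial if there are $l(\varphi)>0$ and a geodesic line $\sigma:\mathbb R\to X_i$ (an axis) with $\varphi(\sigma(t))=\sigma(t+l(\varphi))$ for all $t\in\mathbb R$; then $\mathrm{Ax}(\varphi):=\{x\in X_i: d_i(x,\varphi x)=l(\varphi)\}$. It is called rank one if it has an axis $\sigma$ that does not bound a flat half-plane, i.e. there is no closed convex subset $\iota([0,\infty)\times\mathbb R)\subset X_i$, with $\iota$ an isometric embedding of the Euclidean half-plane, such that $\iota(0,t)=\sigma(t)$ for all $t$. Two axial isometries $\varphi,\psi$ of $X_i$ are called independent if for every $x\in X_i$ the map $\mathbb Z\times\mathbb Z\to[0,\infty)$, $(m,n)\mapsto d_i(\varphi^m x,\psi^n x)$, is proper. An element of $\mathrm{Is}(X_1)\times\cdots\times\mathrm{Is}(X_r)$ is called regular axial if each of its components is rank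 one, and two regular axial elements are called independent if their components in each factor are independent. Let $\Gamma<\mathrm{Is}(X_1)\times\cdots\times\mathrm{Is}(X_r)$ be a discrete group, i.e. a subgroup acting properly discontinuously on $X$ (for every compact $K\subset X$ only finitely many $\gamma\in\Gamma$ satisfy $\gamma K\cap K\neq\emptyset$), which contains two independent regular axial elements $g=(g_1,\dots,g_r)$ and $h=(h_1,\dots,h_r)$. Fix a base point $o=(o_1,\dots,o_r)\in X$ with $o_i\in\mathrm{Ax}(h_i)$ for all $i$. For $\gamma=(\gamma_1,\dots,\gamma_r)\in\Gamma$ put $$H(\gamma):=\big(d_1(o_1,\gamma_1o_1),\dots,d_r(o_r,\gamma_ro_r)\big)\in\mathbb R_{\ge 0}^r,$$ and let $\Vert\cdot\Vert$ be the Euclidean norm on $\mathbb R^r$. Then there exists a map $\pi:\Gamma\times\Gamma\to\Gamma$ with the following properties: (a) There exists $\kappa\ge 0$ such that for all $\alpha,\beta\in\Gamma$ we have $$\Vert H(\pi(\alpha,\beta))-H(\alpha)-H(\beta)\Vert\le\kappa.$$ (b) For every $t>0$ there exists a finite set $\Lambda\subset\Gamma$ such that for all $\alpha,\beta,\widehat\alpha,\widehat\beta\in\Gamma$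 with $\Vert H(\alpha)-H(\widehat\alpha)\Vert\le t$ and $\Vert H(\beta)-H(\widehat\beta)\Vert\le t$ we have $$\pi(\alpha,\beta)=\pi(\widehat\alpha,\widehat\beta)\quad\Longrightarrow\quad\widehat\alpha\in\alpha\Lambda\ \text{ and }\ \widehat\beta\in\Lambda\beta.$$ -/

import Mathlib

/-- `σ`, restricted to `[0, l]`, is a geodesic path joining `x` to `y`. -/
structure IsGeodesicPath {X : Type*} [MetricSpace X] (σ : ℝ → X) (l : ℝ) (x y : X) : Prop where
  length_nonneg : 0 ≤ l
  source : σ 0 = x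
  target : σ l = y
  dist_eq : ∀ s ∈ Set.Icc 0 l, ∀ t ∈ Set.Icc 0 l, dist (σ s) (σ t) = |s - t|

/-- The CAT(0) inequality for all geodesic triangles: if `σ` and `τ` are two sides issuing from the
vertex `x` of a geodesic triangle with vertices `x`, `y`, `z`, then the distance of a point of `σ`
to a point of `τ` is at most the distance of the corresponding points `p'`, `q'` of a comparison
triangle `x'`, `y'`, `z'` in the Euclidean plane. -/
def CAT0Inequality (X : Type*) [MetricSpace X] : Prop :=
  ∀ (x y z : X) (σ τ : ℝ → X) (a b : ℝ), IsGeodesicPath σ a x y → IsGeodesicPath τ b x z →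
    ∀ x' y' z' : EuclideanSpace ℝ (Fin 2),
      dist x' y' = dist x y → dist x' z' = dist x z → dist y' z' = dist y z →
      ∀ s ∈ Set.Icc 0 a, ∀ t ∈ Set.Icc 0 b,
        ∀ p' ∈ segment ℝ x' y', ∀ q' ∈ segment ℝ x' z',
          dist x' p' = dist x (σ s) → dist x' q' = dist x (τ t) →
          dist (σ s) (τ t) ≤ dist p' q'

/-- A Hadamard space: a complete geodesic metric space satisfying the CAT(0) inequality. -/
structure IsHadamardSpace (X : Type*) [MetricSpace X] : Prop where
  complete : CompleteSpace X
  geodesic : ∀ x y : X, ∃ (σ : ℝ → X) (l : ℝ), IsGeodesicPath σ l x y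
  cat0 : CAT0Inequality X

/-- A subset is (geodesically) convex if it contains every geodesic path joining two of its
points. -/
def IsGeodesicallyConvex {X : Type*} [MetricSpace X] (C : Set X) : Prop :=
  ∀ x ∈ C, ∀ y ∈ C, ∀ (σ : ℝ → X) (l : ℝ), IsGeodesicPath σ l x y → ∀ t ∈ Set.Icc 0 l, σ t ∈ C

/-- The geodesic line `σ` bounds a flat half-plane: there is a map `ι` which is isometric on
`[0, ∞) × ℝ` (with its Euclidean metric), has closed convex image, and satisfies
`ι (0, t) = σ t`. -/
def BoundsFlatHalfPlane {X : Type*} [MetricSpace X] (σ : ℝ → X) : Prop :=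
  ∃ ι : ℝ × ℝ → X,
    (∀ p q : ℝ × ℝ, 0 ≤ p.1 → 0 ≤ q.1 →
      dist (ι p) (ι q) = Real.sqrt ((p.1 - q.1) ^ 2 + (p.2 - q.2) ^ 2)) ∧
    IsClosed (ι '' (Set.Ici 0 ×ˢ Set.univ)) ∧
    IsGeodesicallyConvex (ι '' (Set.Ici 0 ×ˢ Set.univ)) ∧
    ∀ t : ℝ, σ t = ι (0, t)

/-- `σ` is a geodesic line which is an axis of `h`, translated by `h` by the length `l > 0`. -/
structure IsAxis {X : Type*} [MetricSpace X] (h : X ≃ᵢ X) (l : ℝ) (σ : ℝ → X) : Prop where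
  length_pos : 0 < l
  geodesic : Isometry σ
  translates : ∀ t : ℝ, h (σ t) = σ (t + l)

/-- A rank one isometry: an axial isometry with an axis that does not bound a flat half-plane. -/
def IsRankOne {X : Type*} [MetricSpace X] (h : X ≃ᵢ X) : Prop :=
  ∃ (l : ℝ) (σ : ℝ → X), IsAxis h l σ ∧ ¬ BoundsFlatHalfPlane σ

/-- For an axial isometry `h` with translation length `l`, the set of points displaced by exactly
`l`. -/
def axisSet {X : Type*} [MetricSpace X] (h : X ≃ᵢ X) : Set X :=
  {x | ∃ (l : ℝ) (σ : ℝ → X), IsAxis h l σ ∧ dist x (h x) = l}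

/-- Independence of two isometries: for every point `x` the map `(m, n) ↦ d(gᵐ x, hⁿ x)` on
`ℤ × ℤ` is proper. -/
def IndependentIsometries {X : Type*} [MetricSpace X] (g h : X ≃ᵢ X) : Prop :=
  ∀ x : X, IsProperMap (fun p : ℤ × ℤ => dist ((g ^ p.1) x) ((h ^ p.2) x))

/-- An element of `Is(X₁) × ⋯ × Is(X_r)` is regular axial if all its components are rank one. -/
def IsRegularAxial {r : ℕ} {X : Fin r → Type*} [∀ i, MetricSpace (X i)]
    (h : ∀ i, X i ≃ᵢ X i) : Prop :=
  ∀ i, IsRankOne (h i)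

/-- The group `Γ < Is(X₁) × ⋯ × Is(X_r)` is discrete, that is, it acts properly discontinuously on
the product space: for every compact `K` only finitely many `γ ∈ Γ` satisfy `γ K ∩ K ≠ ∅`. -/
def IsDiscreteGroup {r : ℕ} {X : Fin r → Type*} [∀ i, MetricSpace (X i)]
    (Γ : Subgroup (∀ i, X i ≃ᵢ X i)) : Prop :=
  ∀ K : Set (∀ i, X i), IsCompact K →
    {γ : ∀ i, X i ≃ᵢ X i | γ ∈ Γ ∧ ((fun (x : ∀ i, X i) i => γ i (x i)) '' K ∩ K).Nonempty}.Finite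

/-- The distance vector `H(x, z) = (d₁(x₁, z₁), …, d_r(x_r, z_r))` in Euclidean `ℝ^r`. -/
noncomputable def distanceVector {r : ℕ} {X : Fin r → Type*} [∀ i, MetricSpace (X i)]
    (x z : ∀ i, X i) : EuclideanSpace ℝ (Fin r) :=
  WithLp.toLp 2 (fun i => dist (x i) (z i))

/-- `H(γ) = H(o, γ o)` for the base point `o`. -/
noncomputable def orbitVector {r : ℕ} {X : Fin r → Type*} [∀ i, MetricSpace (X i)]
    (o : ∀ i, X i) (γ : ∀ i, X i ≃ᵢ X i) : EuclideanSpace ℝ (Fin r) :=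
  distanceVector o (fun i => γ i (o i))

/-! The map has the form `π(α, β) = α γ_j β`, where `γ_j` comes from a fixed finite list in `Γ`. The
index `j` depends on `α` and `β` and is chosen so that in every factor the geodesic from `α_i⁻¹ o_i`
to `γ_{j,i} β_i o_i` passes within a constant `C` of `o_i` (`exists_connecting_family`). Splitting
that geodesic near `o_i` gives (a). For (b), equal products mean that two geodesics from `o_i` have
the same endpoint, hence coincide. One passes near `α_i o_i` and the other near `α'_i o_i`, at
almost the same distance from `o_i`, so `α⁻¹ α'` moves `o` by a bounded amount. The equality of
products then controls `β' β⁻¹` as well, and discreteness makes the set of possibilities finite.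

The connecting elements come from contraction: if the feet of `x` and `y` on a rank one axis are far
apart, the geodesic from `x` to `y` passes near the foot of `x`
(`IsHadamardSpace.exists_contraction`). Where contraction could fail, the distance functions of
points tending to infinity would be almost constant on long pieces of the axis, and a limit of
geodesics to these points would span a flat half-plane (`IsAxis.exists_gap`).

For independent `g` and `h`, the axis of `h` has bounded projection to that of `g`. Hence `gⁿ hᵐ
g⁻ⁿ` with `m` large connects `x` to `y` unless `n` is close to the position of `x` or of `y` along
the axis of `g`. In `r` factors there are `2r` such positions to avoid, so `2r + 1` widely spaced
values of `n` suffice. -/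

/-! ### Geodesic paths and Euclidean comparison triangles. -/

theorem IsGeodesicPath.length_eq {X : Type*} [MetricSpace X] {σ : ℝ → X} {l : ℝ} {x y : X}
    (h : IsGeodesicPath σ l x y) : l = dist x y := by
  have := h.dist_eq 0 ⟨le_rfl, h.length_nonneg⟩ l ⟨h.length_nonneg, le_rfl⟩
  rw [h.source, h.target] at this
  rw [this, zero_sub, abs_neg, abs_of_nonneg h.length_nonneg]

theorem IsGeodesicPath.dist_source {X : Type*} [MetricSpace X] {σ : ℝ → X} {l : ℝ} {x y : X}
    (h : IsGeodesicPath σ l x y) {t : ℝ} (ht : t ∈ Set.Icc 0 l) : dist x (σ t) = t := by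
  have := h.dist_eq 0 ⟨le_rfl, h.length_nonneg⟩ t ht
  rw [h.source] at this
  rw [this, zero_sub, abs_neg, abs_of_nonneg ht.1]

theorem IsGeodesicPath.dist_target {X : Type*} [MetricSpace X] {σ : ℝ → X} {l : ℝ} {x y : X}
    (h : IsGeodesicPath σ l x y) {t : ℝ} (ht : t ∈ Set.Icc 0 l) : dist (σ t) y = l - t := by
  have := h.dist_eq t ht l ⟨h.length_nonneg, le_rfl⟩
  rw [h.target] at this
  rw [this, abs_sub_comm, abs_of_nonneg (sub_nonneg.2 ht.2)]

/-- Every triple of distances in a metric space is realized in the Euclidean plane. -/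
theorem exists_comparison_triangle {X : Type*} [MetricSpace X] (x y z : X) :
    ∃ x' y' z' : EuclideanSpace ℝ (Fin 2),
      dist x' y' = dist x y ∧ dist x' z' = dist x z ∧ dist y' z' = dist y z := by
  set a := dist x y with ha
  set b := dist x z with hb
  set c := dist y z with hc
  have h1 : b ≤ a + c := dist_triangle _ _ _
  have h2 : a ≤ b + c := by
    have := dist_triangle x z y
    rwa [dist_comm z y] at this
  have h3 : c ≤ a + b := by
    have := dist_triangle y x z
    rwa [dist_comm y x] at this
  have ha0 : 0 ≤ a := dist_nonneg
  have hb0 : 0 ≤ b := dist_nonneg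
  have hc0 : 0 ≤ c := dist_nonneg
  set u := (a ^ 2 + b ^ 2 - c ^ 2) / (2 * a) with hu
  have hau : 2 * a * u = a ^ 2 + b ^ 2 - c ^ 2 := by
    rcases eq_or_ne a 0 with h | h
    · have : b = c := by linarith
      rw [h, this]; ring
    · rw [hu]; field_simp
  have hub : 0 ≤ b ^ 2 - u ^ 2 := by
    rcases eq_or_lt_of_le ha0 with h | h
    · have : u = 0 := by rw [hu, ← h]; simp
      rw [this]; nlinarith
    · have e : (2 * a) ^ 2 * (b ^ 2 - u ^ 2) = (2 * a * b) ^ 2 - (2 * a * u) ^ 2 := by ring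
      have : 0 ≤ (2 * a) ^ 2 * (b ^ 2 - u ^ 2) := by
        rw [e, hau]
        have : (2 * a * b) ^ 2 - (a ^ 2 + b ^ 2 - c ^ 2) ^ 2
          = ((a + b + c) * (a + b - c)) * ((c + a - b) * (c + b - a)) := by ring
        rw [this]
        apply mul_nonneg <;> apply mul_nonneg <;> linarith
      exact nonneg_of_mul_nonneg_right this (by positivity)
  have hv : √(b ^ 2 - u ^ 2) ^ 2 = b ^ 2 - u ^ 2 := Real.sq_sqrt hub
  refine ⟨!₂[0, 0], !₂[a, 0], !₂[u, √(b ^ 2 - u ^ 2)], ?_, ?_, ?_⟩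
  · rw [EuclideanSpace.dist_eq]
    simp [Fin.sum_univ_two, Real.dist_eq, Real.sqrt_sq ha0]
  · rw [EuclideanSpace.dist_eq]
    simp only [Fin.sum_univ_two, Real.dist_eq, sq_abs]
    simp [hv, Real.sqrt_sq hb0]
  · rw [EuclideanSpace.dist_eq]
    simp only [Fin.sum_univ_two, Real.dist_eq, sq_abs]
    simp only [Matrix.cons_val_zero, Matrix.cons_val_one, zero_sub, neg_sq, hv]
    rw [show (a - u) ^ 2 + (b ^ 2 - u ^ 2) = c ^ 2 by linarith, Real.sqrt_sq hc0]

/-- Stewart's theorem in a real inner product space. -/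
theorem norm_sq_affine_combination {E : Type*} [NormedAddCommGroup E] [InnerProductSpace ℝ E]
    (v w : E) (c : ℝ) :
    ‖(1 - c) • v + c • w‖ ^ 2 = (1 - c) * ‖v‖ ^ 2 + c * ‖w‖ ^ 2 - c * (1 - c) * ‖v - w‖ ^ 2 := by
  rw [norm_add_sq_real, norm_sub_sq_real, norm_smul, norm_smul, inner_smul_left, inner_smul_right,
    mul_pow, mul_pow]
  simp only [Real.norm_eq_abs, sq_abs, conj_trivial]
  ring

/-! ### Metric inequalities in CAT(0) spaces. -/

namespace IsHadamardSpace

variable {X : Type*} [MetricSpace X]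

/-- The CAT(0) inequality with the second point at the end `z` of its side, followed by Stewart's
theorem in the plane. The factor `l` avoids division and covers the degenerate path. All later
comparison arguments rest on this inequality alone. -/
theorem stewart_path (hX : IsHadamardSpace X) {σ : ℝ → X} {l : ℝ} {x y : X}
    (h : IsGeodesicPath σ l x y) {t : ℝ} (ht : t ∈ Set.Icc 0 l) (z : X) :
    l * dist (σ t) z ^ 2 ≤ (l - t) * dist x z ^ 2 + t * dist y z ^ 2 - t * (l - t) * l := by
  obtain ⟨x', y', z', h1, h2, h3⟩ := exists_comparison_triangle x y z
  obtain ⟨τ, b, hτ⟩ := hX.geodesic x z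
  have hl := h.length_eq
  rcases eq_or_lt_of_le h.length_nonneg with h0 | h0
  · have : t = 0 := le_antisymm (by rw [h0]; exact ht.2) ht.1
    rw [← h0, this]; simp
  have hc0 : 0 ≤ t / l := div_nonneg ht.1 h0.le
  have hc1 : t / l ≤ 1 := (div_le_one h0).2 ht.2
  have key := hX.cat0 x y z σ τ l b h hτ x' y' z' h1 h2 h3 t ht b ⟨hτ.length_nonneg, le_rfl⟩
    ((1 - t / l) • x' + (t / l) • y') ⟨1 - t / l, t / l, by linarith, hc0, by ring, rfl⟩
    z' (right_mem_segment ℝ x' z') ?_ ?_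
  · rw [hτ.target] at key
    have e : dist ((1 - t / l) • x' + (t / l) • y') z' ^ 2
        = (1 - t / l) * dist x z ^ 2 + t / l * dist y z ^ 2 - t / l * (1 - t / l) * l ^ 2 := by
      have := norm_sq_affine_combination (x' - z') (y' - z') (t / l)
      rw [sub_sub_sub_cancel_right, ← dist_eq_norm, ← dist_eq_norm, ← dist_eq_norm, h1, h2, h3,
        ← hl] at this
      rw [dist_eq_norm, ← this]
      congr 2
      module
    have : dist (σ t) z ^ 2 ≤ _ := pow_le_pow_left₀ dist_nonneg key 2
    rw [e] at this
    calc l * dist (σ t) z ^ 2 ≤ l * _ := mul_le_mul_of_nonneg_left this h0.le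
      _ = _ := by field_simp
  · rw [h.dist_source ht, dist_eq_norm,
      show x' - ((1 - t / l) • x' + (t / l) • y') = (t / l) • (x' - y') by module, norm_smul,
      ← dist_eq_norm, h1, ← hl, Real.norm_eq_abs, abs_of_nonneg hc0]
    field_simp
  · rw [hτ.target, h2]

/-- A point metrically between the endpoints of a geodesic path lies on the path. -/
theorem eq_of_between (hX : IsHadamardSpace X) {σ : ℝ → X} {l : ℝ} {x y m : X}
    (h : IsGeodesicPath σ l x y) (hm : dist x m + dist m y = dist x y) :
    σ (dist x m) = m := by
  have hl := h.length_eq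
  have ht : dist x m ∈ Set.Icc 0 l :=
    ⟨dist_nonneg, by rw [hl, ← hm]; linarith [@dist_nonneg _ _ m y]⟩
  rcases eq_or_lt_of_le h.length_nonneg with h0 | h0
  · have : dist x m = 0 := le_antisymm (by rw [h0]; exact ht.2) ht.1
    rw [this, h.source]
    exact dist_eq_zero.1 this
  -- At the parameter `dist x m`, the right-hand side of Stewart's inequality for the point `m` is
  -- zero.
  have key := hX.stewart_path h ht m
  have e : l - dist x m = dist m y := by rw [hl, ← hm]; ring
  have e2 : dist y m = dist m y := dist_comm _ _
  rw [e, e2] at key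
  have : l * dist (σ (dist x m)) m ^ 2 ≤ 0 := by
    rw [hl, ← hm] at key ⊢
    linarith
  have : dist (σ (dist x m)) m ^ 2 ≤ 0 := by
    by_contra hh
    push Not at hh
    nlinarith
  exact dist_eq_zero.1 (pow_eq_zero_iff two_ne_zero |>.1 (le_antisymm this (sq_nonneg _)))

/-- Stewart's inequality: the squared distance to a point is strongly convex. -/
theorem stewart (hX : IsHadamardSpace X) {x y m : X}
    (hm : dist x m + dist m y = dist x y) (z : X) :
    dist x y * dist m z ^ 2 ≤
      dist m y * dist x z ^ 2 + dist x m * dist y z ^ 2 - dist x m * dist m y * dist x y := by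
  obtain ⟨σ, l, h⟩ := hX.geodesic x y
  have hl := h.length_eq
  have e := hX.eq_of_between h hm
  have key := hX.stewart_path h
    ⟨dist_nonneg, by rw [hl, ← hm]; linarith [@dist_nonneg _ _ m y]⟩ z (t := dist x m)
  rw [e, hl] at key
  have : dist x y - dist x m = dist m y := by rw [← hm]; ring
  rw [this] at key
  exact key

theorem exists_between (hX : IsHadamardSpace X) (x y : X) {t : ℝ} (h0 : 0 ≤ t)
    (h1 : t ≤ dist x y) : ∃ m, dist x m = t ∧ dist m y = dist x y - t := by
  obtain ⟨σ, l, h⟩ := hX.geodesic x y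
  have hl := h.length_eq
  have ht : t ∈ Set.Icc 0 l := ⟨h0, by rw [hl]; exact h1⟩
  exact ⟨σ t, h.dist_source ht, by rw [h.dist_target ht, hl]⟩

/-- Points between `x` and `y` are determined up to distance by their distance to `x`. -/
theorem dist_between_between (hX : IsHadamardSpace X) {x y m n : X}
    (hm : dist x m + dist m y = dist x y) (hn : dist x n + dist n y = dist x y) :
    dist m n = |dist x m - dist x n| := by
  obtain ⟨σ, l, h⟩ := hX.geodesic x y
  have hl := h.length_eq
  have := h.dist_eq (dist x m) ⟨dist_nonneg, by rw [hl, ← hm]; linarith [@dist_nonneg _ _ m y]⟩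
    (dist x n) ⟨dist_nonneg, by rw [hl, ← hn]; linarith [@dist_nonneg _ _ n y]⟩
  rwa [hX.eq_of_between h hm, hX.eq_of_between h hn] at this

theorem dist_between_le_max (hX : IsHadamardSpace X) {x y m : X}
    (hm : dist x m + dist m y = dist x y) (z : X) :
    dist m z ≤ max (dist x z) (dist y z) := by
  have key := hX.stewart hm z
  set M := max (dist x z) (dist y z)
  have h1 : dist x z ≤ M := le_max_left _ _
  have h2 : dist y z ≤ M := le_max_right _ _
  have hx : 0 ≤ dist x m := dist_nonneg
  have hy : 0 ≤ dist m y := dist_nonneg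
  rcases eq_or_lt_of_le (@dist_nonneg _ _ x y) with h0 | h0
  · have : dist x m = 0 := by linarith
    rw [← dist_eq_zero.1 this]; exact h1
  have h3 : dist x z ^ 2 ≤ M ^ 2 := pow_le_pow_left₀ dist_nonneg h1 2
  have h4 : dist y z ^ 2 ≤ M ^ 2 := pow_le_pow_left₀ dist_nonneg h2 2
  have : dist x y * dist m z ^ 2 ≤ dist x y * M ^ 2 := by
    calc _ ≤ _ := key
      _ ≤ dist m y * M ^ 2 + dist x m * M ^ 2 := by
        have := mul_le_mul_of_nonneg_left h3 hy
        have := mul_le_mul_of_nonneg_left h4 hx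
        have := mul_nonneg (mul_nonneg hx hy) h0.le
        linarith
      _ = _ := by rw [← hm]; ring
  exact le_of_sq_le_sq (le_of_mul_le_mul_left this h0) (dist_nonneg.trans h1)

/-- Comparison of points on two sides of a triangle with its Euclidean comparison triangle. -/
theorem dist_sq_comparison (hX : IsHadamardSpace X) {x y z m n : X}
    (hm : dist x m + dist m y = dist x y) (hn : dist x n + dist n z = dist x z) :
    dist x y * dist x z * dist m n ^ 2 ≤ dist x y * dist x z * (dist x m ^ 2 + dist x n ^ 2)
      - dist x m * dist x n * (dist x y ^ 2 + dist x z ^ 2 - dist y z ^ 2) := by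
  -- Stewart is used twice: `m` on the side `xy` seen from `z`, then `n` on the side `xz` seen from
  -- `m`.
  have k1 := hX.stewart hm z
  have k2 := hX.stewart hn m
  have k3 := mul_le_mul_of_nonneg_left k1 (@dist_nonneg _ _ x n)
  have k4 := mul_le_mul_of_nonneg_left k2 (@dist_nonneg _ _ x y)
  rw [dist_comm n m, dist_comm z m] at k4
  have e1 : dist m y = dist x y - dist x m := by rw [← hm]; ring
  have e2 : dist n z = dist x z - dist x n := by rw [← hn]; ring
  rw [e1] at k3
  rw [e2] at k4
  nlinarith

/-- The quadrilateral inequality. -/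
theorem quadrilateral (hX : IsHadamardSpace X) (a b x y : X) :
    dist a y ^ 2 + dist x b ^ 2 ≤ dist a x ^ 2 + dist y b ^ 2 + dist a b ^ 2 + dist x y ^ 2 := by
  -- The midpoint of the diagonal `xb`: Stewart bounds its distances to `a` and `y`, and these bound
  -- the other diagonal.
  obtain ⟨m, h1, h2⟩ := hX.exists_between x b (t := dist x b / 2)
    (by positivity) (by linarith [@dist_nonneg _ _ x b])
  have hm : dist x m + dist m b = dist x b := by rw [h1, h2]; ring
  have k1 := hX.stewart hm a
  have k2 := hX.stewart hm y
  rcases eq_or_lt_of_le (@dist_nonneg _ _ x b) with h0 | h0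
  · have := dist_eq_zero.1 h0.symm
    subst this
    rw [dist_self, dist_comm y x]
    have := dist_triangle a x y
    nlinarith [sq_nonneg (dist a x - dist x y), @dist_nonneg _ _ a y]
  have e : dist m b = dist x b / 2 := by rw [h2]; ring
  rw [h1, e] at k1 k2
  have k1' : dist m a ^ 2 ≤ dist x a ^ 2 / 2 + dist b a ^ 2 / 2 - dist x b ^ 2 / 4 := by
    refine le_of_mul_le_mul_left ?_ h0; linarith
  have k2' : dist m y ^ 2 ≤ dist x y ^ 2 / 2 + dist b y ^ 2 / 2 - dist x b ^ 2 / 4 := by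
    refine le_of_mul_le_mul_left ?_ h0; linarith
  have k3 := dist_triangle a m y
  rw [dist_comm a x, dist_comm a b, dist_comm y b]
  rw [dist_comm a m] at k3
  have : dist a y ^ 2 ≤ (dist m a + dist m y) ^ 2 := pow_le_pow_left₀ dist_nonneg k3 2
  nlinarith [sq_nonneg (dist m a - dist m y)]

end IsHadamardSpace

/-! ### Projection to a geodesic line. -/

section GeodesicLine

variable {X : Type*} [MetricSpace X]

theorem Isometry.dist_line {σ : ℝ → X} (hσ : Isometry σ) (s t : ℝ) :
    dist (σ s) (σ t) = |s - t| := by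
  rw [hσ.dist_eq, Real.dist_eq]

theorem Isometry.between_line {σ : ℝ → X} (hσ : Isometry σ) {s t u : ℝ} (h1 : s ≤ t)
    (h2 : t ≤ u) : dist (σ s) (σ t) + dist (σ t) (σ u) = dist (σ s) (σ u) := by
  rw [hσ.dist_line, hσ.dist_line, hσ.dist_line, abs_of_nonpos (by linarith),
    abs_of_nonpos (by linarith), abs_of_nonpos (by linarith)]
  ring

theorem exists_forall_dist_line_le {σ : ℝ → X} (hσ : Isometry σ) (x : X) :
    ∃ a, ∀ t, dist x (σ a) ≤ dist x (σ t) := by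
  refine Continuous.exists_forall_le (f := fun t => dist x (σ t))
    (continuous_const.dist hσ.continuous) ?_
  have h : ∀ t, |t| - dist x (σ 0) ≤ dist x (σ t) := by
    intro t
    have := dist_triangle_left (σ t) (σ 0) x
    rw [hσ.dist_line, sub_zero] at this
    linarith
  have := tendsto_norm_cocompact_atTop (E := ℝ)
  exact Filter.tendsto_atTop_mono h (Filter.tendsto_atTop_add_const_right _ _ this)

/-- The parameter of the nearest point projection of `x` to the geodesic line `σ`. -/
noncomputable def lineProj (σ : ℝ → X) (x : X) : ℝ :=
  Classical.epsilon fun a => ∀ t, dist x (σ a) ≤ dist x (σ t)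

theorem dist_lineProj_le {σ : ℝ → X} (hσ : Isometry σ) (x : X) (t : ℝ) :
    dist x (σ (lineProj σ x)) ≤ dist x (σ t) :=
  Classical.epsilon_spec (exists_forall_dist_line_le hσ x) t

namespace IsHadamardSpace

/-- A Pythagorean inequality expressing that the angle at the foot is at least `π / 2`. It is the
first-order part, as `c → 0`, of Stewart's inequality at the point a fraction `c` of the way from
the foot to `σ t`. -/
theorem sq_add_sq_le_of_forall_le (hX : IsHadamardSpace X) {σ : ℝ → X} (hσ : Isometry σ) {x : X}
    {a : ℝ} (ha : ∀ t, dist x (σ a) ≤ dist x (σ t)) (t : ℝ) :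
    dist x (σ a) ^ 2 + (t - a) ^ 2 ≤ dist x (σ t) ^ 2 := by
  rcases eq_or_ne t a with h | h
  · rw [h]; simp
  have hl : 0 < |a - t| := abs_pos.2 (sub_ne_zero.2 h.symm)
  have key : ∀ c : ℝ, 0 < c → c ≤ 1 →
      dist x (σ a) ^ 2 + (1 - c) * (t - a) ^ 2 ≤ dist x (σ t) ^ 2 := by
    intro c h0 h1
    have d1 : dist (σ a) (σ (a + c * (t - a))) = c * |a - t| := by
      rw [hσ.dist_line, show a - (a + c * (t - a)) = c * (a - t) by ring, abs_mul, abs_of_pos h0]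
    have d2 : dist (σ (a + c * (t - a))) (σ t) = (1 - c) * |a - t| := by
      rw [hσ.dist_line, show a + c * (t - a) - t = (1 - c) * (a - t) by ring, abs_mul,
        abs_of_nonneg (by linarith)]
    have d3 : dist (σ a) (σ t) = |a - t| := hσ.dist_line _ _
    have := hX.stewart (x := σ a) (y := σ t) (m := σ (a + c * (t - a)))
      (by rw [d1, d2, d3]; ring) x
    rw [d1, d2, d3] at this
    have k : dist (σ (a + c * (t - a))) x ^ 2 ≤ (1 - c) * dist (σ a) x ^ 2 + c * dist (σ t) x ^ 2
        - c * (1 - c) * |a - t| ^ 2 := by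
      refine le_of_mul_le_mul_left ?_ hl
      linarith
    have k2 : dist x (σ a) ^ 2 ≤ dist (σ (a + c * (t - a))) x ^ 2 := by
      rw [dist_comm _ x]
      exact pow_le_pow_left₀ dist_nonneg (ha _) 2
    rw [dist_comm _ x, dist_comm _ x, dist_comm _ x, sq_abs] at k
    rw [dist_comm _ x] at k2
    refine le_of_mul_le_mul_left ?_ h0
    nlinarith
  by_contra hh
  push Not at hh
  set e := dist x (σ a) ^ 2 + (t - a) ^ 2 - dist x (σ t) ^ 2 with he
  have he0 : 0 < e := by linarith
  have hp : 0 < (t - a) ^ 2 := by positivity [sub_ne_zero.2 h]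
  -- This value of `c` makes the error `c * (t - a) ^ 2` at most half of the supposed defect `e`.
  have k1 := key (min 1 (e / (2 * (t - a) ^ 2))) (lt_min one_pos (by positivity)) (min_le_left _ _)
  have k2 : min 1 (e / (2 * (t - a) ^ 2)) * (t - a) ^ 2 ≤ e / 2 := by
    calc _ ≤ e / (2 * (t - a) ^ 2) * (t - a) ^ 2 :=
          mul_le_mul_of_nonneg_right (min_le_right _ _) hp.le
      _ = e / 2 := by field_simp
  linarith

theorem sq_add_sq_le (hX : IsHadamardSpace X) {σ : ℝ → X} (hσ : Isometry σ) (x : X) (t : ℝ) :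
    dist x (σ (lineProj σ x)) ^ 2 + (t - lineProj σ x) ^ 2 ≤ dist x (σ t) ^ 2 :=
  hX.sq_add_sq_le_of_forall_le hσ (dist_lineProj_le hσ x) t

theorem lineProj_eq (hX : IsHadamardSpace X) {σ : ℝ → X} (hσ : Isometry σ) {x : X} {a : ℝ}
    (ha : ∀ t, dist x (σ a) ≤ dist x (σ t)) : lineProj σ x = a := by
  have h1 := hX.sq_add_sq_le_of_forall_le hσ ha (lineProj σ x)
  have h2 := pow_le_pow_left₀ dist_nonneg (dist_lineProj_le hσ x a) 2
  have : (lineProj σ x - a) ^ 2 ≤ 0 := by linarith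
  have := pow_eq_zero_iff two_ne_zero |>.1 (le_antisymm this (sq_nonneg _))
  linarith

theorem lineProj_line (hX : IsHadamardSpace X) {σ : ℝ → X} (hσ : Isometry σ) (a : ℝ) :
    lineProj σ (σ a) = a :=
  hX.lineProj_eq hσ fun t => by rw [dist_self]; exact dist_nonneg

/-- The Pythagorean inequalities at both feet bound the diagonals of the quadrilateral formed by
`x`, `y` and their feet from below; the quadrilateral inequality bounds them from above. -/
theorem abs_lineProj_sub_le (hX : IsHadamardSpace X) {σ : ℝ → X} (hσ : Isometry σ) (x y : X) :
    |lineProj σ x - lineProj σ y| ≤ dist x y := by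
  have h1 := hX.sq_add_sq_le hσ x (lineProj σ y)
  have h2 := hX.sq_add_sq_le hσ y (lineProj σ x)
  have h3 := hX.quadrilateral (σ (lineProj σ x)) (σ (lineProj σ y)) x y
  rw [dist_comm _ y, dist_comm _ x, hσ.dist_line, sq_abs] at h3
  apply abs_le_of_sq_le_sq _ dist_nonneg
  nlinarith

theorem continuous_lineProj (hX : IsHadamardSpace X) {σ : ℝ → X} (hσ : Isometry σ) :
    Continuous (lineProj σ) :=
  LipschitzWith.continuous (K := 1) <| LipschitzWith.of_dist_le_mul fun x y => by
    simpa [Real.dist_eq] using hX.abs_lineProj_sub_le hσ x y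

/-- Points between `x` and its foot on the line have the same foot. -/
theorem lineProj_of_between (hX : IsHadamardSpace X) {σ : ℝ → X} (hσ : Isometry σ) {x z : X}
    (h : dist x z + dist z (σ (lineProj σ x)) = dist x (σ (lineProj σ x))) :
    lineProj σ z = lineProj σ x :=
  hX.lineProj_eq hσ fun t => by
    have := dist_lineProj_le hσ x t
    have := dist_triangle x z (σ t)
    linarith

end IsHadamardSpace

theorem IsAxis.zpow_apply {h : X ≃ᵢ X} {l : ℝ} {σ : ℝ → X} (hσ : IsAxis h l σ) (n : ℤ) (t : ℝ) :
    (h ^ n) (σ t) = σ (t + n * l) := by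
  induction n generalizing t with
  | zero => simp
  | succ n ih =>
    rw [zpow_add_one, IsometryEquiv.mul_apply, hσ.translates, ih]
    push_cast; congr 1; ring
  | pred n ih =>
    rw [zpow_sub_one, IsometryEquiv.mul_apply]
    have : h⁻¹ (σ t) = σ (t - l) := by
      have := hσ.translates (t - l)
      rw [sub_add_cancel] at this
      rw [← this, ← IsometryEquiv.mul_apply, inv_mul_cancel]; rfl
    rw [this, ih]
    push_cast; congr 1; ring

theorem IsAxis.lineProj_zpow {h : X ≃ᵢ X} {l : ℝ} {σ : ℝ → X} (hσ : IsAxis h l σ)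
    (hX : IsHadamardSpace X) (n : ℤ) (x : X) :
    lineProj σ ((h ^ n) x) = lineProj σ x + n * l :=
  hX.lineProj_eq hσ.geodesic fun t => by
    rw [← hσ.zpow_apply, IsometryEquiv.dist_eq, show t = (t - n * l) + n * l by ring,
      ← hσ.zpow_apply, IsometryEquiv.dist_eq]
    exact dist_lineProj_le hσ.geodesic _ _

end GeodesicLine

/-! ### Construction of flat half-planes. -/

namespace IsHadamardSpace

open Filter Topology

variable {X : Type*} [MetricSpace X]

/-- Distance of two points at distances `u`, `v` from the base of a triangle with apex `y`. -/
theorem dist_sq_le_of_apex (hX : IsHadamardSpace X) {y p q m n : X} {u v : ℝ}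
    (hp : 0 < dist y p) (hq : 0 < dist y q) (hu : 0 ≤ u) (hv : 0 ≤ v)
    (hup : dist p m = u) (hum : dist m y = dist p y - u)
    (hvq : dist q n = v) (hvn : dist n y = dist q y - v) :
    dist m n ^ 2 ≤ dist p q ^ 2 + (|u - v| + |dist y p - dist y q|) ^ 2 := by
  have e1 : dist y m = dist y p - u := by rw [dist_comm y m, hum, dist_comm]
  have e2 : dist y n = dist y q - v := by rw [dist_comm y n, hvn, dist_comm]
  have key := hX.dist_sq_comparison (x := y) (y := p) (z := q) (m := m) (n := n)
    (by rw [e1, dist_comm m p, hup]; ring) (by rw [e2, dist_comm n q, hvq]; ring)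
  have um : 0 ≤ dist y m := dist_nonneg
  have vn : 0 ≤ dist y n := dist_nonneg
  rw [e1] at um
  rw [e2] at vn
  rw [e1, e2] at key
  set b := dist y p
  set c := dist y q
  set a := dist p q with ha
  have hbc : (b - c) ^ 2 ≤ a ^ 2 := by
    apply sq_le_sq'
    · have : c ≤ b + a := dist_triangle y p q
      linarith
    · have : b ≤ c + a := by
        have := dist_triangle y q p
        rwa [dist_comm q p] at this
      linarith
  have h1 : (b - u) * (c - v) ≤ b * c :=
    mul_le_mul (by linarith) (by linarith) vn hp.le
  have h2 : ((b - u) - (c - v)) ^ 2 ≤ (|u - v| + |b - c|) ^ 2 := by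
    apply sq_le_sq.2
    rw [abs_of_nonneg (by positivity : 0 ≤ |u - v| + |b - c|),
      show (b - u) - (c - v) = (b - c) - (u - v) by ring, add_comm]
    exact abs_sub _ _
  -- The cosine rule at the apex, with the angle eliminated through the sides `a`, `b`, `c` of the
  -- large triangle.
  have h3 : b * c * dist m n ^ 2 ≤ b * c * ((b - u) - (c - v)) ^ 2
      + (b - u) * (c - v) * (a ^ 2 - (b - c) ^ 2) := by linarith
  have h4 : (b - u) * (c - v) * (a ^ 2 - (b - c) ^ 2) ≤ b * c * a ^ 2 := by
    calc _ ≤ b * c * (a ^ 2 - (b - c) ^ 2) := mul_le_mul_of_nonneg_right h1 (by linarith)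
      _ ≤ _ := by
        have := mul_nonneg (mul_nonneg hp.le hq.le) (sq_nonneg (b - c))
        linarith
  have hpq := mul_pos hp hq
  refine le_of_mul_le_mul_left ?_ hpq
  have := mul_le_mul_of_nonneg_left h2 hpq.le
  linarith

/-- If a family of points `ι (u, t)` satisfies the upper bounds of a Euclidean half-plane along
a line, then it satisfies them with equality. -/
theorem halfPlane_rigidity (hX : IsHadamardSpace X) {σ : ℝ → X} (hσ : Isometry σ)
    {ι : ℝ × ℝ → X} (h0 : ∀ u t, 0 ≤ u → dist (σ t) (ι (u, t)) = u)
    (hle : ∀ p q : ℝ × ℝ, 0 ≤ p.1 → 0 ≤ q.1 →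
      dist (ι p) (ι q) ^ 2 ≤ (p.1 - q.1) ^ 2 + (p.2 - q.2) ^ 2) :
    ∀ p q : ℝ × ℝ, 0 ≤ p.1 → 0 ≤ q.1 →
      dist (ι p) (ι q) = Real.sqrt ((p.1 - q.1) ^ 2 + (p.2 - q.2) ^ 2) := by
  have hι0 : ∀ t, ι (0, t) = σ t := fun t => (dist_eq_zero.1 (h0 0 t le_rfl)).symm
  have hvert : ∀ u v t, 0 ≤ u → 0 ≤ v → dist (ι (u, t)) (ι (v, t)) = |u - v| := by
    intro u v t hu hv
    apply le_antisymm
    · have := hle (u, t) (v, t) hu hv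
      apply le_of_sq_le_sq _ (abs_nonneg _)
      rw [sq_abs]
      simpa using this
    · have h1 := h0 u t hu
      have h2 := h0 v t hv
      have h3 := dist_triangle (σ t) (ι (u, t)) (ι (v, t))
      have h4 := dist_triangle_right (σ t) (ι (u, t)) (ι (v, t))
      rw [abs_le]
      constructor <;> linarith
  have hhor : ∀ u s t, 0 ≤ u → s ≤ t → t - s ≤ dist (ι (u, s)) (ι (u, t)) := by
    intro u s t hu hst
    -- The path from `σ (s - R)` to `σ (t + R)` through `ι (u, s)` and `ι (u, t)` is at least as
    -- long as the line segment, and each outer leg exceeds `R` by at most `u ^ 2 / (2 * R)`.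
    have key : ∀ R, 0 < R → t - s ≤ dist (ι (u, s)) (ι (u, t)) + u ^ 2 / R := by
      intro R hR
      have b : ∀ r a, 0 ≤ u → |r - a| = R → dist (σ a) (ι (u, r)) ≤ R + u ^ 2 / (2 * R) := by
        intro r a hu hr
        have := hle (0, a) (u, r) le_rfl hu
        simp only [hι0] at this
        apply le_of_sq_le_sq _ (by positivity)
        have e : (a - r) ^ 2 = R ^ 2 := by rw [← hr, sq_abs]; ring
        have : (R + u ^ 2 / (2 * R)) ^ 2 = R ^ 2 + u ^ 2 + (u ^ 2 / (2 * R)) ^ 2 := by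
          field_simp; ring
        have := sq_nonneg (u ^ 2 / (2 * R))
        nlinarith
      have b1 := b s (s - R) hu (by rw [sub_sub_cancel, abs_of_pos hR])
      have b2 := b t (t + R) hu (by rw [sub_add_cancel_left, abs_neg, abs_of_pos hR])
      have b3 : dist (σ (s - R)) (σ (t + R)) = t - s + 2 * R := by
        rw [hσ.dist_line, abs_of_nonpos (by linarith)]; ring
      have b4 := dist_triangle4 (σ (s - R)) (ι (u, s)) (ι (u, t)) (σ (t + R))
      rw [dist_comm (ι (u, t)) (σ (t + R))] at b4
      have : u ^ 2 / R = u ^ 2 / (2 * R) + u ^ 2 / (2 * R) := by field_simp; ring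
      linarith
    refine le_of_forall_pos_le_add fun ε hε => ?_
    have := key ((u ^ 2 + 1) / ε) (by positivity)
    refine this.trans ?_
    gcongr
    rw [div_div_eq_mul_div, div_le_iff₀ (by positivity)]
    nlinarith
  have hhor' : ∀ u s t, 0 ≤ u → |s - t| ≤ dist (ι (u, s)) (ι (u, t)) := by
    intro u s t hu
    rcases le_total s t with h | h
    · rw [abs_of_nonpos (by linarith)]; linarith [hhor u s t hu h]
    · rw [abs_of_nonneg (by linarith), dist_comm]; exact hhor u t s hu h
  have hge : ∀ u v s t, 0 < u → 0 ≤ v →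
      (u - v) ^ 2 + (t - s) ^ 2 ≤ dist (ι (u, t)) (ι (v, s)) ^ 2 := by
    intro u v s t hu hv
    have hh : (t - s) ^ 2 ≤ dist (ι (u, t)) (ι (u, s)) ^ 2 := by
      rw [← sq_abs (t - s)]
      exact pow_le_pow_left₀ (abs_nonneg _) (hhor' u t s hu.le) 2
    rcases eq_or_ne v u with h | h
    · rw [h]; simpa using hh
    -- A height beyond `u` as seen from `v`: Stewart turns the upper bound at `v'` and the lower
    -- bound at `u` into a lower bound at `v`. For `v > u` such a height exists only because `u >
    -- 0`.
    obtain ⟨v', hv', hb⟩ : ∃ v', 0 ≤ v' ∧ |v - u| + |u - v'| = |v - v'| ∧ 0 < |u - v'| := by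
      rcases lt_or_gt_of_ne h with h | h
      · refine ⟨u + 1, by linarith, ?_⟩
        rw [abs_of_neg (by linarith), abs_of_neg (by linarith), abs_of_neg (by linarith)]
        constructor <;> linarith
      · refine ⟨0, le_rfl, ?_⟩
        rw [abs_of_pos (by linarith), abs_of_pos (by linarith), abs_of_pos (by linarith)]
        constructor <;> linarith
    have st := hX.stewart (x := ι (v, s)) (y := ι (v', s)) (m := ι (u, s))
      (by rw [hvert _ _ _ hv hu.le, hvert _ _ _ hu.le hv', hvert _ _ _ hv hv', hb.1]) (ι (u, t))
    rw [hvert _ _ _ hv hu.le, hvert _ _ _ hu.le hv', hvert _ _ _ hv hv', ← hb.1] at st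
    have up := hle (v', s) (u, t) hv' hu.le
    simp only at up
    rw [dist_comm (ι (u, t)) (ι (u, s))] at hh
    rw [dist_comm (ι (u, t)) (ι (v, s))]
    set A := |v - u|
    set B := |u - v'|
    have eA : A ^ 2 = (u - v) ^ 2 := by rw [sq_abs]; ring
    have eB : B ^ 2 = (v' - u) ^ 2 := by rw [sq_abs]; ring
    have hA : 0 ≤ A := abs_nonneg _
    have hB := hb.2
    rw [← eA]
    rw [← eB] at up
    refine le_of_mul_le_mul_left ?_ hB
    have k1 := mul_le_mul_of_nonneg_left up hA
    have k2 := mul_le_mul_of_nonneg_left hh (add_nonneg hA hB.le)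
    have e3 : (s - t) ^ 2 = (t - s) ^ 2 := by ring
    rw [e3] at k1
    nlinarith
  have hge' : ∀ p q : ℝ × ℝ, 0 ≤ p.1 → 0 ≤ q.1 →
      (p.1 - q.1) ^ 2 + (p.2 - q.2) ^ 2 ≤ dist (ι p) (ι q) ^ 2 := by
    rintro ⟨u, t⟩ ⟨v, s⟩ hu hv
    simp only at hu hv ⊢
    rcases eq_or_lt_of_le hu with h | h
    · rcases eq_or_lt_of_le hv with h' | h'
      · rw [← h, ← h', hι0, hι0, hσ.dist_line, sq_abs]; simp
      · have := hge v u t s h' hu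
        rw [dist_comm] at this
        linarith
    · exact hge u v s t h hv
  intro p q hp hq
  rw [le_antisymm (hge' p q hp hq) (hle p q hp hq), Real.sqrt_sq dist_nonneg]

/-- An isometric image of the Euclidean half-plane is closed and convex. -/
theorem boundsFlatHalfPlane_of_isometric (hX : IsHadamardSpace X) {σ : ℝ → X} {ι : ℝ × ℝ → X}
    (hι : ∀ p q : ℝ × ℝ, 0 ≤ p.1 → 0 ≤ q.1 →
      dist (ι p) (ι q) = Real.sqrt ((p.1 - q.1) ^ 2 + (p.2 - q.2) ^ 2))
    (hσ : ∀ t, σ t = ι (0, t)) : BoundsFlatHalfPlane σ := by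
  refine ⟨ι, hι, ?_, ?_, hσ⟩
  · rw [Set.image_eq_range]
    have hS : IsClosed (Set.Ici (0 : ℝ) ×ˢ (Set.univ : Set ℝ)) := isClosed_Ici.prod isClosed_univ
    have : CompleteSpace (Set.Ici (0 : ℝ) ×ˢ (Set.univ : Set ℝ) : Set (ℝ × ℝ)) :=
      hS.completeSpace_coe
    refine AntilipschitzWith.isClosed_range (K := 1) (AntilipschitzWith.of_le_mul_dist ?_) ?_
    · rintro ⟨p, hp⟩ ⟨q, hq⟩
      rw [hι p q hp.1 hq.1, NNReal.coe_one, one_mul, Subtype.dist_eq, Prod.dist_eq]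
      apply max_le
      · rw [Real.dist_eq, ← Real.sqrt_sq_eq_abs]
        exact Real.sqrt_le_sqrt (by simpa using sq_nonneg (p.2 - q.2))
      · rw [Real.dist_eq, ← Real.sqrt_sq_eq_abs]
        exact Real.sqrt_le_sqrt (by simpa using sq_nonneg (p.1 - q.1))
    · refine LipschitzWith.uniformContinuous (K := 2) (LipschitzWith.of_dist_le_mul ?_)
      rintro ⟨p, hp⟩ ⟨q, hq⟩
      rw [hι p q hp.1 hq.1, Subtype.dist_eq]
      apply Real.sqrt_le_iff.2
      refine ⟨by positivity, ?_⟩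
      have h1 : |p.1 - q.1| ≤ dist p q := by
        rw [Prod.dist_eq, Real.dist_eq]; exact le_max_left _ _
      have h2 : |p.2 - q.2| ≤ dist p q := by
        rw [Prod.dist_eq, Real.dist_eq, Real.dist_eq]; exact le_max_right _ _
      have h1 := pow_le_pow_left₀ (abs_nonneg _) h1 2
      have h2 := pow_le_pow_left₀ (abs_nonneg _) h2 2
      rw [sq_abs] at h1 h2
      have : (((2 : NNReal) : ℝ) * dist p q) ^ 2 = 4 * dist p q ^ 2 := by push_cast; ring
      simp only at this ⊢
      rw [this]
      nlinarith [sq_nonneg (dist p q)]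
  · rintro _ ⟨p, hp, rfl⟩ _ ⟨q, hq, rfl⟩ τ l hτ t ht
    have hl := hτ.length_eq
    rcases eq_or_lt_of_le hτ.length_nonneg with h0 | h0
    · have : t = 0 := le_antisymm (by rw [h0]; exact ht.2) ht.1
      rw [this, hτ.source]; exact ⟨p, hp, rfl⟩
    have hc0 : 0 ≤ t / l := div_nonneg ht.1 h0.le
    have hc1 : t / l ≤ 1 := (div_le_one h0).2 ht.2
    set c := t / l
    have htc : t = c * l := by simp only [c]; field_simp
    have hp1 : 0 ≤ p.1 := hp.1
    have hq1 : 0 ≤ q.1 := hq.1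
    set m : ℝ × ℝ := ((1 - c) * p.1 + c * q.1, (1 - c) * p.2 + c * q.2) with hm
    have hm1 : 0 ≤ m.1 :=
      add_nonneg (mul_nonneg (by linarith) hp1) (mul_nonneg hc0 hq1)
    have d1 : dist (ι p) (ι m) = t := by
      rw [hι p m hp1 hm1, show (p.1 - m.1) ^ 2 + (p.2 - m.2) ^ 2
        = c ^ 2 * ((p.1 - q.1) ^ 2 + (p.2 - q.2) ^ 2) by rw [hm]; ring,
        Real.sqrt_mul (sq_nonneg c), Real.sqrt_sq hc0, ← hι p q hp1 hq1, ← hl, htc]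
    have d2 : dist (ι m) (ι q) = l - t := by
      rw [hι m q hm1 hq1, show (m.1 - q.1) ^ 2 + (m.2 - q.2) ^ 2
        = (1 - c) ^ 2 * ((p.1 - q.1) ^ 2 + (p.2 - q.2) ^ 2) by rw [hm]; ring,
        Real.sqrt_mul (sq_nonneg _), Real.sqrt_sq (by linarith), ← hι p q hp1 hq1, ← hl, htc]
      ring
    have := hX.eq_of_between hτ (m := ι m) (by rw [d1, d2, ← hl]; ring)
    rw [d1] at this
    exact ⟨m, ⟨hm1, trivial⟩, this.symm⟩

/-- A geodesic line along which some horofunction is constant bounds a flat half-plane. -/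
theorem boundsFlatHalfPlane_of_tendsto [ProperSpace X] (hX : IsHadamardSpace X) {σ : ℝ → X}
    (hσ : Isometry σ) {y : ℕ → X} {A : ℕ → ℝ} (hA : Tendsto A atTop atTop)
    (hy : ∀ s, Tendsto (fun n => dist (y n) (σ s) - A n) atTop (𝓝 0)) :
    BoundsFlatHalfPlane σ := by
  have htop : ∀ s, Tendsto (fun n => dist (y n) (σ s)) atTop atTop := by
    intro s
    have := (hy s).add_atTop hA
    simpa using this
  have hdiff : ∀ s t, Tendsto (fun n => dist (y n) (σ s) - dist (y n) (σ t)) atTop (𝓝 0) := by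
    intro s t
    simpa using (hy s).sub (hy t)
  have hc : ∀ (n : ℕ) (p : ℝ × ℝ), ∃ c, 0 ≤ p.1 → p.1 ≤ dist (σ p.2) (y n) →
      dist (σ p.2) c = p.1 ∧ dist c (y n) = dist (σ p.2) (y n) - p.1 := by
    intro n p
    by_cases h : 0 ≤ p.1 ∧ p.1 ≤ dist (σ p.2) (y n)
    · obtain ⟨c, hc⟩ := hX.exists_between _ _ h.1 h.2
      exact ⟨c, fun _ _ => hc⟩
    · exact ⟨σ 0, fun h1 h2 => absurd ⟨h1, h2⟩ h⟩
  choose c hc using hc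
  -- One ultrafilter makes the points at distance `p.1` on the geodesics from `σ p.2` to `y n`
  -- converge for all `p` simultaneously, since closed balls are compact.
  set U : Ultrafilter ℕ := hyperfilter ℕ
  have hU : (U : Filter ℕ) ≤ atTop := Nat.hyperfilter_le_atTop
  have hcev : ∀ p : ℝ × ℝ, 0 ≤ p.1 → ∀ᶠ n in atTop, 0 < dist (y n) (σ p.2) ∧
      dist (σ p.2) (c n p) = p.1 ∧ dist (c n p) (y n) = dist (σ p.2) (y n) - p.1 := by
    intro p hp
    filter_upwards [(htop p.2).eventually_ge_atTop p.1, (htop p.2).eventually_gt_atTop 0]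
      with n h1 h2
    exact ⟨h2, hc n p hp (by rw [dist_comm]; exact h1)⟩
  have hlim : ∀ p : ℝ × ℝ, ∃ z, 0 ≤ p.1 → Tendsto (fun n => c n p) U (𝓝 z) := by
    intro p
    by_cases hp : 0 ≤ p.1
    · obtain ⟨z, -, hz⟩ := (isCompact_closedBall (σ p.2) p.1).ultrafilter_le_nhds'
        (U.map fun n => c n p) (by
          have : ∀ᶠ n in (U : Filter ℕ), c n p ∈ Metric.closedBall (σ p.2) p.1 := by
            filter_upwards [hU (hcev p hp)] with n hn
            rw [Metric.mem_closedBall, dist_comm]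
            exact hn.2.1.le
          exact this)
      exact ⟨z, fun _ => hz⟩
    · exact ⟨σ 0, fun h => absurd h hp⟩
  choose ι hι using hlim
  have h0 : ∀ u t, 0 ≤ u → dist (σ t) (ι (u, t)) = u := by
    intro u t hu
    have h1 : Tendsto (fun n => dist (σ t) (c n (u, t))) U (𝓝 (dist (σ t) (ι (u, t)))) :=
      tendsto_const_nhds.dist (hι (u, t) hu)
    refine tendsto_nhds_unique h1 (tendsto_const_nhds.congr' ?_)
    filter_upwards [hU (hcev (u, t) hu)] with n hn
    exact hn.2.1.symm
  refine hX.boundsFlatHalfPlane_of_isometric (ι := ι) (hX.halfPlane_rigidity hσ h0 ?_)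
    fun t => dist_eq_zero.1 (h0 0 t le_rfl)
  intro p q hp hq
  have h1 : Tendsto (fun n => dist (c n p) (c n q) ^ 2) U (𝓝 (dist (ι p) (ι q) ^ 2)) :=
    ((hι p hp).dist (hι q hq)).pow 2
  have h2 : Tendsto (fun n => dist (σ p.2) (σ q.2) ^ 2
      + (|p.1 - q.1| + |dist (y n) (σ p.2) - dist (y n) (σ q.2)|) ^ 2) U
      (𝓝 (dist (σ p.2) (σ q.2) ^ 2 + (|p.1 - q.1| + |0|) ^ 2)) :=
    ((((hdiff p.2 q.2).mono_left hU).abs.const_add _).pow 2).const_add _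
  have := le_of_tendsto_of_tendsto h1 h2 (by
    filter_upwards [hU (hcev p hp), hU (hcev q hq)] with n hp' hq'
    exact hX.dist_sq_le_of_apex hp'.1 hq'.1 hp hq hp'.2.1 hp'.2.2 hq'.2.1 hq'.2.2)
  rw [abs_zero, add_zero, sq_abs, hσ.dist_line, sq_abs] at this
  linarith

end IsHadamardSpace

/-! ### Rank one axes are contracting. -/

section Contraction

open Filter Topology

variable {X : Type*} [MetricSpace X]

theorem IsHadamardSpace.dist_line_le_max (hX : IsHadamardSpace X) {σ : ℝ → X} (hσ : Isometry σ)
    (x : X) {a b s : ℝ} (hs : s ∈ Set.uIcc a b) :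
    dist x (σ s) ≤ max (dist x (σ a)) (dist x (σ b)) := by
  rw [dist_comm x, dist_comm x, dist_comm x]
  rcases Set.mem_uIcc.1 hs with h | h
  · exact hX.dist_between_le_max (hσ.between_line h.1 h.2) x
  · rw [max_comm]
    exact hX.dist_between_le_max (hσ.between_line h.1 h.2) x

/-- The distance function to a point increases definitely along a rank one axis, uniformly in the
point, once one moves away from the nearest point. -/
theorem IsAxis.exists_gap [ProperSpace X] (hX : IsHadamardSpace X) {h : X ≃ᵢ X} {l : ℝ}
    {σ : ℝ → X} (hσ : IsAxis h l σ) (hn : ¬ BoundsFlatHalfPlane σ) :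
    ∃ T δ : ℝ, 0 < T ∧ 0 < δ ∧ ∀ x t, T ≤ |t - lineProj σ x| →
      dist x (σ (lineProj σ x)) + δ ≤ dist x (σ t) := by
  by_contra! hcon
  apply hn
  have hl := hσ.length_pos
  have step : ∀ n : ℕ, ∃ (y : X) (A : ℝ), (n : ℝ) / 2 ≤ A ∧
      ∀ s, |s| + l ≤ ((n : ℝ) + 1) / 2 →
        A ≤ dist y (σ s) ∧ dist y (σ s) ≤ A + 1 / ((n : ℝ) + 1) := by
    intro n
    have hN : (0 : ℝ) < (n : ℝ) + 1 := by positivity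
    obtain ⟨x, t, h1, h2⟩ := hcon ((n : ℝ) + 1) (1 / ((n : ℝ) + 1)) hN (by positivity)
    set a := lineProj σ x
    set A := dist x (σ a) with hA
    -- Translation by `h ^ k` moves the midpoint of `a` and `t` into `[0, l]`, so the translated
    -- intervals, of length at least `n + 1`, exhaust the line. On them the distance function is
    -- within `1 / (n + 1)` of its minimum `A`, by convexity.
    set k : ℤ := -⌊(a + t) / 2 / l⌋ with hk
    have hshift : ∀ s, dist ((h ^ k) x) (σ s) = dist x (σ (s - k * l)) := by
      intro s
      have := hσ.zpow_apply k (s - k * l)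
      rw [sub_add_cancel] at this
      rw [← this, IsometryEquiv.dist_eq]
    have hc1 : 0 ≤ (a + t) / 2 + k * l := by
      have := Int.floor_le ((a + t) / 2 / l)
      rw [le_div_iff₀ hl] at this
      rw [hk]; push_cast; linarith
    have hc2 : (a + t) / 2 + k * l ≤ l := by
      have := (Int.lt_floor_add_one ((a + t) / 2 / l)).le
      rw [div_le_iff₀ hl] at this
      rw [hk]; push_cast; linarith
    refine ⟨(h ^ k) x, A, ?_, ?_⟩
    · have p := hX.sq_add_sq_le hσ.geodesic x t
      have q := pow_le_pow_left₀ dist_nonneg h2.le 2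
      have r := pow_le_pow_left₀ hN.le h1 2
      rw [sq_abs] at r
      have hA0 : 0 ≤ A := dist_nonneg
      have e1 : 1 / ((n : ℝ) + 1) ≤ 1 := by
        rw [div_le_one hN]; linarith [(Nat.cast_nonneg n : (0 : ℝ) ≤ n)]
      have e0 : 0 ≤ 1 / ((n : ℝ) + 1) := by positivity
      have : ((n : ℝ) + 1) ^ 2 ≤ 2 * A + 1 := by
        nlinarith [mul_le_mul_of_nonneg_left e1 hA0]
      nlinarith [(Nat.cast_nonneg n : (0 : ℝ) ≤ n)]
    · intro s hs
      rw [hshift]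
      refine ⟨dist_lineProj_le hσ.geodesic x _, ?_⟩
      have hs1 := neg_abs_le s
      have hs2 := le_abs_self s
      have hmem : s - k * l ∈ Set.uIcc a t := by
        rw [Set.mem_uIcc]
        rcases le_total a t with hat | hat
        · left
          rw [abs_of_nonneg (by linarith)] at h1
          constructor <;> linarith
        · right
          rw [abs_of_nonpos (by linarith)] at h1
          constructor <;> linarith
      refine (hX.dist_line_le_max hσ.geodesic x hmem).trans (max_le ?_ h2.le)
      have : 0 ≤ 1 / ((n : ℝ) + 1) := by positivity
      linarith
  choose y A hA hy using step
  refine hX.boundsFlatHalfPlane_of_tendsto hσ.geodesic (y := y) (A := A) ?_ ?_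
  · exact tendsto_atTop_mono hA (tendsto_natCast_atTop_atTop.atTop_div_const two_pos)
  · intro s
    refine squeeze_zero' (t₀ := atTop) ?_ ?_ tendsto_one_div_add_atTop_nhds_zero_nat
    all_goals
      filter_upwards [(tendsto_natCast_atTop_atTop (R := ℝ)).eventually_ge_atTop (2 * (|s| + l))]
        with n hn
      have := hy n s (by linarith)
      linarith

/-- The comparison angle at `o` of the triangle `o`, `x`, `y`. -/
noncomputable def comparisonAngle (o x y : X) : ℝ :=
  Real.arccos ((dist o x ^ 2 + dist o y ^ 2 - dist x y ^ 2) / (2 * dist o x * dist o y))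

theorem comparisonAngle_comm (o x y : X) : comparisonAngle o x y = comparisonAngle o y x := by
  rw [comparisonAngle, comparisonAngle, dist_comm x y]
  congr 1
  ring

theorem comparisonAngle_eq_angle {o x y : X} {o' x' y' : EuclideanSpace ℝ (Fin 2)}
    (h1 : dist o' x' = dist o x) (h2 : dist o' y' = dist o y) (h3 : dist x' y' = dist x y) :
    comparisonAngle o x y = EuclideanGeometry.angle x' o' y' := by
  rw [comparisonAngle, EuclideanGeometry.angle, InnerProductGeometry.angle,
    real_inner_eq_norm_mul_self_add_norm_mul_self_sub_norm_sub_mul_self_div_two,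
    vsub_sub_vsub_cancel_right, ← dist_eq_norm_vsub, ← dist_eq_norm_vsub, ← dist_eq_norm_vsub,
    dist_comm x' o', dist_comm y' o', h1, h2, h3, div_div]
  congr 2 <;> ring

theorem comparisonAngle_sum {o x y : X} (h : o ≠ x) :
    comparisonAngle o x y + comparisonAngle x y o + comparisonAngle y o x = Real.pi := by
  obtain ⟨o', x', y', e1, e2, e3⟩ := exists_comparison_triangle o x y
  rw [comparisonAngle_eq_angle e1 e2 e3,
    comparisonAngle_eq_angle (o' := x') (x' := y') (y' := o') e3 (by rw [dist_comm, e1, dist_comm])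
      (by rw [dist_comm, e2, dist_comm]),
    comparisonAngle_eq_angle (o' := y') (x' := o') (y' := x') (by rw [dist_comm, e2, dist_comm])
      (by rw [dist_comm, e3, dist_comm]) e1]
  have hx : x' ≠ o' := by
    rw [← dist_pos, dist_comm, e1]; exact dist_pos.2 h
  have := EuclideanGeometry.angle_add_angle_add_angle_eq_pi (p₁ := x') (p₂ := o') y' hx.symm
  linarith

/-- Stewart's inequality at `m` says exactly that the cosines of the two adjacent comparison angles
have nonpositive sum. -/
theorem IsHadamardSpace.pi_le_comparisonAngle_add (hX : IsHadamardSpace X) {x y m o : X}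
    (hm : dist x m + dist m y = dist x y) (hx : x ≠ m) (hy : m ≠ y) (ho : m ≠ o) :
    Real.pi ≤ comparisonAngle m x o + comparisonAngle m y o := by
  have key := hX.stewart hm o
  have hx := dist_pos.2 hx
  have hy := dist_pos.2 hy
  have ho := dist_pos.2 ho
  unfold comparisonAngle
  rw [dist_comm m x]
  set p := dist x m
  set q := dist m y
  set D := dist m o
  have : (p ^ 2 + D ^ 2 - dist x o ^ 2) / (2 * p * D)
      ≤ -((q ^ 2 + D ^ 2 - dist y o ^ 2) / (2 * q * D)) := by
    rw [← neg_div, div_le_div_iff₀ (by positivity) (by positivity)]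
    rw [← hm] at key
    have : q * (p ^ 2 + D ^ 2 - dist x o ^ 2) + p * (q ^ 2 + D ^ 2 - dist y o ^ 2) ≤ 0 := by
      linarith
    nlinarith
  have := Real.antitone_arccos this
  rw [Real.arccos_neg] at this
  linarith

/-- The comparison angles at `o` of consecutive points on a geodesic add up to at most `π`. -/
theorem IsHadamardSpace.mul_le_pi_of_le_comparisonAngle (hX : IsHadamardSpace X) {z : ℕ → X}
    {o : X} {θ : ℝ} {N : ℕ} (ho : ∀ k ≤ N + 1, o ≠ z k) (hz : ∀ k ≤ N, z k ≠ z (k + 1))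
    (hb : ∀ k < N, dist (z k) (z (k + 1)) + dist (z (k + 1)) (z (k + 2)) = dist (z k) (z (k + 2)))
    (hθ : ∀ k ≤ N, θ ≤ comparisonAngle o (z k) (z (k + 1))) : N * θ ≤ Real.pi := by
  -- The forward angle at `z k` grows by `θ` per step: the angle sum of the triangle `o`, `z k`, `z
  -- (k + 1)` bounds the backward angle at `z (k + 1)`, and adjacent angles add up to at least `π`.
  have key : ∀ k ≤ N, k * θ ≤ comparisonAngle (z k) (z (k + 1)) o := by
    intro k
    induction k with
    | zero => intro _; rw [Nat.cast_zero, zero_mul]; exact Real.arccos_nonneg _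
    | succ k ih =>
      intro hk
      have h1 := ih (by omega)
      have h2 := hθ k (by omega)
      have h3 := comparisonAngle_sum (y := z (k + 1)) (ho k (by omega))
      have h4 := hX.pi_le_comparisonAngle_add (o := o) (hb k (by omega)) (hz k (by omega))
        (hz (k + 1) (by omega)) (ho (k + 1) (by omega)).symm
      rw [comparisonAngle_comm (z (k + 1)) o] at h3
      push_cast
      linarith
  exact (key N le_rfl).trans (Real.arccos_le_pi _)

/-- Two points with distant feet are seen from one of the feet under a definite comparison
angle. -/
theorem IsHadamardSpace.le_dist_sq_of_gap (hX : IsHadamardSpace X) {σ : ℝ → X} (hσ : Isometry σ)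
    {T δ : ℝ} (hT : 0 < T) (hδ : 0 < δ)
    (hgap : ∀ x t, T ≤ |t - lineProj σ x| → dist x (σ (lineProj σ x)) + δ ≤ dist x (σ t))
    {z w : X} (hzw : |lineProj σ z - lineProj σ w| = T)
    (hz : T ^ 2 / δ ≤ dist z (σ (lineProj σ z))) (hw : T ^ 2 / δ ≤ dist w (σ (lineProj σ w))) :
    (dist z (σ (lineProj σ w)) - dist w (σ (lineProj σ w))) ^ 2
      + (δ / (T ^ 2 / δ)) ^ 2 * (dist z (σ (lineProj σ w)) * dist w (σ (lineProj σ w)))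
      ≤ dist z w ^ 2 := by
  -- At distance `ρ` from `σ b`, the point `m` towards `z` is within `ρ` of `σ a`, whereas the point
  -- `n` towards `w` has foot `b` and so is at least `ρ + δ` from `σ a`. Hence `m` and `n` are `δ`
  -- apart, which bounds the comparison angle at `σ b` from below.
  set ρ := T ^ 2 / δ with hρ
  have hρ0 : 0 < ρ := by positivity
  have hρδ : ρ * δ = T ^ 2 := by rw [hρ]; field_simp
  set a := lineProj σ z
  set b := lineProj σ w with hb
  have g1 := hgap z b (by rw [abs_sub_comm, hzw])
  obtain ⟨m, hm1, hm2⟩ := hX.exists_between (σ b) z hρ0.le (by rw [dist_comm]; linarith)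
  obtain ⟨n, hn1, hn2⟩ := hX.exists_between (σ b) w hρ0.le (by rw [dist_comm]; linarith)
  have hm : dist (σ b) m + dist m z = dist (σ b) z := by rw [hm1, hm2]; ring
  have hn : dist (σ b) n + dist n w = dist (σ b) w := by rw [hn1, hn2]; ring
  have hPn : lineProj σ n = b := by
    refine hX.lineProj_of_between hσ (x := w) ?_
    rw [← hb, dist_comm w n, dist_comm n (σ b), dist_comm w (σ b), add_comm]
    exact hn
  have g2 := hgap n a (by rw [hPn, hzw])
  rw [hPn, dist_comm n, hn1] at g2
  have s1 := hX.stewart hm (σ a)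
  have key := hX.dist_sq_comparison hm hn
  rw [hm1, hm2, hσ.dist_line, sq_abs, show (b - a) ^ 2 = T ^ 2 by rw [← hzw, sq_abs]; ring,
    dist_comm _ z, ← hρδ] at s1
  rw [hm1, hn1, dist_comm _ z, dist_comm _ w] at key
  set d := dist z (σ b)
  set B := dist w (σ b)
  set A := dist z (σ a)
  have hA : 0 ≤ A := dist_nonneg
  have hd : 0 < d := by linarith
  have hB : 0 < B := by linarith
  have s2 : dist m (σ a) ≤ ρ := by
    apply le_of_sq_le_sq _ hρ0.le
    refine le_of_mul_le_mul_left ?_ hd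
    have : δ * d ≤ d ^ 2 - A ^ 2 := by nlinarith
    nlinarith [mul_le_mul_of_nonneg_left this hρ0.le, mul_pos (mul_pos hρ0 hρ0) hδ]
  have s3 : δ ≤ dist m n := by
    have := dist_triangle n m (σ a)
    rw [dist_comm n m] at this
    linarith
  have s4 := pow_le_pow_left₀ hδ.le s3 2
  have s5 := mul_le_mul_of_nonneg_left s4 (mul_pos hd hB).le
  have s6 : (δ / ρ) ^ 2 * (d * B) = d * B * δ ^ 2 / ρ ^ 2 := by ring
  rw [s6, ← sub_nonneg]
  have : ρ ^ 2 * (dist z w ^ 2 - ((d - B) ^ 2 + d * B * δ ^ 2 / ρ ^ 2))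
      = ρ ^ 2 * (dist z w ^ 2 - (d - B) ^ 2) - d * B * δ ^ 2 := by field_simp; ring
  refine nonneg_of_mul_nonneg_right (a := ρ ^ 2) ?_ (by positivity)
  rw [this]
  nlinarith

/-- Stability of the cosine rule under bounded perturbation of two long sides. -/
theorem le_sq_of_perturbation {d B D E M η ℓ : ℝ} (hη : 0 < η) (hM : 0 ≤ M)
    (h1 : |D - d| ≤ M) (h2 : |E - B| ≤ M) (hD1 : 16 * M ≤ η * D) (hE1 : 16 * M ≤ η * E)
    (hD2 : 8 * M ≤ D) (hE2 : 8 * M ≤ E)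
    (h : (d - B) ^ 2 + η * (d * B) ≤ ℓ ^ 2) : (D - E) ^ 2 + η / 2 * (D * E) ≤ ℓ ^ 2 := by
  rw [abs_le] at h1 h2
  have hD : 0 ≤ D := by linarith
  have hE : 0 ≤ E := by linarith
  have k1 : (D - E) ^ 2 - η / 4 * (D * E) ≤ (d - B) ^ 2 := by
    have f1 := mul_le_mul_of_nonneg_right hD1 hE
    have f2 := mul_le_mul_of_nonneg_right hE1 hD
    rcases le_total (2 * M) |D - E| with hc | hc
    · have g1 : |D - E| - 2 * M ≤ |d - B| := by
        have := abs_sub_abs_le_abs_sub (D - E) (d - B)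
        have : |(D - E) - (d - B)| ≤ 2 * M := by rw [abs_le]; constructor <;> linarith
        linarith
      have g2 := pow_le_pow_left₀ (by linarith) g1 2
      rw [sq_abs] at g2
      have g3 : |D - E| ^ 2 = (D - E) ^ 2 := sq_abs _
      have g4 : M * |D - E| * 4 ≤ η / 4 * (D * E) := by
        rcases abs_cases (D - E) with h | h <;> rw [h.1]
        · nlinarith
        · nlinarith
      nlinarith
    · have g3 : |D - E| ^ 2 = (D - E) ^ 2 := sq_abs _
      have : |D - E| ^ 2 ≤ (2 * M) * (2 * M) := by
        rw [sq]; exact mul_le_mul hc hc (abs_nonneg _) (by linarith)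
      nlinarith [mul_le_mul_of_nonneg_left hD2 hM, sq_nonneg (d - B)]
  have k2 : 3 / 4 * (D * E) ≤ d * B := by
    have : (D - M) * (E - M) ≤ d * B :=
      mul_le_mul (by linarith) (by linarith) (by linarith) (by linarith)
    nlinarith [mul_le_mul_of_nonneg_right hD2 hE, mul_le_mul_of_nonneg_right hE2 hD]
  nlinarith [mul_le_mul_of_nonneg_left k2 hη.le]

/-- The last time with `q ≤ c` is monotone in `c`, and the intermediate value theorem shows that `q
= c` there. -/
theorem exists_monotone_hitting {q : ℝ → ℝ} {l M : ℝ} (hl : 0 ≤ l)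
    (hq : ContinuousOn q (Set.Icc 0 l)) (h0 : q 0 = 0) (hM : M ≤ q l) :
    ∃ τ : ℝ → ℝ, (∀ c ∈ Set.Icc 0 M, τ c ∈ Set.Icc 0 l ∧ q (τ c) = c) ∧
      MonotoneOn τ (Set.Icc 0 M) := by
  have hex : ∀ c, ∃ t, c ∈ Set.Icc 0 M → IsGreatest {t | t ∈ Set.Icc 0 l ∧ q t ≤ c} t := by
    intro c
    by_cases hc : c ∈ Set.Icc 0 M
    · have hclosed : IsClosed {t | t ∈ Set.Icc 0 l ∧ q t ≤ c} :=
        hq.preimage_isClosed_of_isClosed isClosed_Icc isClosed_Iic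
      have hcomp : IsCompact {t | t ∈ Set.Icc 0 l ∧ q t ≤ c} :=
        isCompact_Icc.of_isClosed_subset hclosed fun t ht => ht.1
      obtain ⟨t, ht⟩ := hcomp.exists_isGreatest ⟨0, ⟨le_rfl, hl⟩, by rw [h0]; exact hc.1⟩
      exact ⟨t, fun _ => ht⟩
    · exact ⟨0, fun h => absurd h hc⟩
  choose τ hτ using hex
  refine ⟨τ, fun c hc => ⟨(hτ c hc).1.1, ?_⟩, fun c hc c' hc' h => ?_⟩
  · have ht := (hτ c hc).1
    have hub := (hτ c hc).2
    have hcl : c ≤ q l := hc.2.trans hM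
    obtain ⟨s, hs, hsc⟩ := intermediate_value_Icc ht.1.2
      (hq.mono (Set.Icc_subset_Icc_left ht.1.1)) ⟨ht.2, hcl⟩
    have : s ≤ τ c := hub ⟨⟨ht.1.1.trans hs.1, hs.2⟩, hsc.le⟩
    rw [← le_antisymm this hs.1, hsc]
  · exact (hτ c' hc').2 ⟨(hτ c hc).1.1, (hτ c hc).1.2.trans h⟩

/-- Suppose the geodesic from `x` to `y` stays at distance at least `K` from the line while its foot
advances through `N + 1` steps of length `T`. The points reached after consecutive steps are then
seen from the foot of `x` under comparison angles at least `θ`, and `N * θ > π` is impossible. So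
the geodesic comes within `K` of the line while its foot is still within `M` of the foot of `x`. -/
theorem IsHadamardSpace.exists_contraction (hX : IsHadamardSpace X) {σ : ℝ → X}
    (hσ : Isometry σ) {T δ : ℝ} (hT : 0 < T) (hδ : 0 < δ)
    (hgap : ∀ x t, T ≤ |t - lineProj σ x| → dist x (σ (lineProj σ x)) + δ ≤ dist x (σ t)) :
    ∃ D, 0 < D ∧ ∀ x y, D ≤ |lineProj σ x - lineProj σ y| →
      ∃ z, dist x z + dist z y = dist x y ∧ dist z (σ (lineProj σ x)) ≤ D := by
  set ρ := T ^ 2 / δ with hρ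
  have hρ0 : 0 < ρ := by positivity
  set η := (δ / ρ) ^ 2 with hη
  have hη0 : 0 < η := by positivity
  set θ := Real.arccos (1 - η / 4) with hθ
  have hθ0 : 0 < θ := Real.arccos_pos.2 (by linarith)
  obtain ⟨N, hN⟩ := exists_nat_gt (Real.pi / θ)
  rw [div_lt_iff₀ hθ0] at hN
  set M := ((N : ℝ) + 1) * T with hMdef
  have hM0 : 0 < M := by positivity
  -- The angle estimate holds at the foot of `z (k + 1)`, which is within `M` of the foot of `x`. At
  -- distance `K` this change of viewpoint costs at most half of `η`, which leaves cosine at most `1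
  -- - η / 4`.
  set K := max ρ (max (16 * M / η) (8 * M)) with hK
  have hK1 : ρ ≤ K := le_max_left _ _
  have hK2 : 16 * M ≤ η * K := by
    have : 16 * M / η ≤ K := (le_max_left _ _).trans (le_max_right _ _)
    rw [div_le_iff₀ hη0] at this
    linarith
  have hK3 : 8 * M ≤ K := (le_max_right _ _).trans (le_max_right _ _)
  refine ⟨K + M, by linarith, fun x y hxy => ?_⟩
  -- The sign `s` is the direction in which the foot moves from `x` to `y`.
  obtain ⟨s, hs2, hs⟩ : ∃ s : ℝ, s * s = 1 ∧
      s * (lineProj σ y - lineProj σ x) = |lineProj σ x - lineProj σ y| := by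
    rcases le_total (lineProj σ x) (lineProj σ y) with h | h
    · exact ⟨1, by ring, by rw [abs_of_nonpos (by linarith)]; ring⟩
    · exact ⟨-1, by ring, by rw [abs_of_nonneg (by linarith)]; ring⟩
  have hsabs : |s| = 1 := by
    have : |s| * |s| = 1 := by rw [← abs_mul, hs2, abs_one]
    nlinarith [abs_nonneg s]
  obtain ⟨γ, l, hγ⟩ := hX.geodesic x y
  have hl := hγ.length_nonneg
  have hγc : ContinuousOn γ (Set.Icc 0 l) :=
    LipschitzOnWith.continuousOn (K := 1) <| LipschitzOnWith.of_dist_le_mul fun u hu v hv => by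
      rw [hγ.dist_eq u hu v hv, Real.dist_eq]; simp
  obtain ⟨τ, hτ, hτm⟩ := exists_monotone_hitting
    (q := fun t => s * (lineProj σ (γ t) - lineProj σ x)) (M := M) hl
    (continuousOn_const.mul (((hX.continuous_lineProj hσ).comp_continuousOn hγc).sub
      continuousOn_const))
    (by simp [hγ.source]) (by simp only [hγ.target, hs]; linarith)
  have hck : ∀ k : ℕ, k ≤ N + 1 → (k : ℝ) * T ∈ Set.Icc 0 M := by
    intro k hk
    refine ⟨by positivity, mul_le_mul_of_nonneg_right ?_ hT.le⟩
    exact_mod_cast hk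
  set z : ℕ → X := fun k => γ (τ (k * T)) with hz
  have hP : ∀ k ≤ N + 1, lineProj σ (z k) = lineProj σ x + s * (k * T) := by
    intro k hk
    have := (hτ _ (hck k hk)).2
    rw [← this, ← mul_assoc, hs2]; ring
  have hbx : ∀ k ≤ N + 1, dist x (z k) + dist (z k) y = dist x y := by
    intro k hk
    rw [hγ.dist_source (hτ _ (hck k hk)).1, hγ.dist_target (hτ _ (hck k hk)).1, hγ.length_eq]
    ring
  have hdz : ∀ j k, j ≤ k → k ≤ N + 1 → dist (z j) (z k) = τ (k * T) - τ (j * T) := by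
    intro j k hjk hk
    rw [hγ.dist_eq _ (hτ _ (hck j (hjk.trans hk))).1 _ (hτ _ (hck k hk)).1, abs_sub_comm,
      abs_of_nonneg]
    rw [sub_nonneg]
    refine hτm (hck j (hjk.trans hk)) (hck k hk) (mul_le_mul_of_nonneg_right ?_ hT.le)
    exact_mod_cast hjk
  have hox : ∀ k ≤ N + 1, |lineProj σ x - lineProj σ (z k)| ≤ M := by
    intro k hk
    rw [hP k hk, sub_add_cancel_left, abs_neg, abs_mul, hsabs, one_mul,
      abs_of_nonneg (by positivity)]
    exact (hck k hk).2
  by_cases hsmall : ∃ k ≤ N + 1, dist (z k) (σ (lineProj σ (z k))) < K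
  · obtain ⟨k, hk, hlt⟩ := hsmall
    refine ⟨z k, hbx k hk, ?_⟩
    have := dist_triangle_right (z k) (σ (lineProj σ x)) (σ (lineProj σ (z k)))
    rw [hσ.dist_line] at this
    linarith [hox k hk]
  exfalso
  push Not at hsmall
  set o := σ (lineProj σ x) with ho
  have hD : ∀ k ≤ N + 1, K ≤ dist o (z k) := fun k hk => by
    rw [dist_comm]
    exact (hsmall k hk).trans (dist_lineProj_le hσ _ _)
  have hKpos : 0 < K := by linarith
  have hstep : ∀ k ≤ N, |lineProj σ (z k) - lineProj σ (z (k + 1))| = T := by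
    intro k hk
    rw [hP k (by omega), hP (k + 1) (by omega)]
    push_cast
    rw [show lineProj σ x + s * (k * T) - (lineProj σ x + s * ((k + 1) * T)) = -(s * T) by ring,
      abs_neg, abs_mul, hsabs, one_mul, abs_of_pos hT]
  have := hX.mul_le_pi_of_le_comparisonAngle (z := z) (o := o) (θ := θ) (N := N)
    (fun k hk => dist_pos.1 (hKpos.trans_le (hD k hk)))
    (fun k hk h => by
      have := hstep k hk
      rw [h, sub_self, abs_zero] at this
      exact hT.ne this)
    (fun k hk => by
      rw [hdz k (k + 1) (by omega) (by omega), hdz (k + 1) (k + 2) (by omega) (by omega),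
        hdz k (k + 2) (by omega) (by omega)]
      ring)
    (fun k hk => by
      have hp := hX.le_dist_sq_of_gap hσ hT hδ hgap (hstep k hk)
        (hK1.trans (hsmall k (by omega))) (hK1.trans (hsmall (k + 1) (by omega)))
      have hpert : ∀ j ≤ N + 1, |dist o (z j) - dist (z j) (σ (lineProj σ (z (k + 1))))| ≤ M := by
        intro j _
        rw [dist_comm o]
        refine (abs_dist_sub_le o _ (z j) |>.trans' ?_).trans
          ((hσ.dist_line _ _).trans_le (hox (k + 1) (by omega)))
        rw [dist_comm (z j), dist_comm (z j)]
      have hD1 := hD k (by omega)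
      have hE1 := hD (k + 1) (by omega)
      have hc := le_sq_of_perturbation hη0 hM0.le (hpert k (by omega)) (hpert (k + 1) (by omega))
        (hK2.trans (mul_le_mul_of_nonneg_left hD1 hη0.le))
        (hK2.trans (mul_le_mul_of_nonneg_left hE1 hη0.le)) (hK3.trans hD1) (hK3.trans hE1) hp
      rw [hθ, comparisonAngle]
      apply Real.antitone_arccos
      have hD0 := hKpos.trans_le hD1
      have hE0 := hKpos.trans_le hE1
      rw [div_le_iff₀ (by positivity)]
      nlinarith)
  linarith

end Contraction

/-- The Hopf–Rinow theorem for locally compact Hadamard spaces. -/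
theorem IsHadamardSpace.properSpace {X : Type*} [MetricSpace X] [LocallyCompactSpace X]
    (hX : IsHadamardSpace X) : ProperSpace X := by
  have := hX.complete
  refine ⟨fun x r => ?_⟩
  by_contra hr
  set S := {r : ℝ | IsCompact (Metric.closedBall x r)} with hS
  have hdown : ∀ a b, a ≤ b → b ∈ S → a ∈ S := fun a b hab hb =>
    hb.of_isClosed_subset Metric.isClosed_closedBall (Metric.closedBall_subset_closedBall hab)
  have hbdd : BddAbove S := ⟨r, fun a ha => le_of_not_gt fun h => hr (hdown r a h.le ha)⟩
  have h0 : (0 : ℝ) ∈ S := by simp [hS]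
  set R := sSup S with hR
  have hR0 : 0 ≤ R := le_csSup hbdd h0
  have hnear : ∀ a b, 0 ≤ a → ∀ y ∈ Metric.closedBall x b, a ≤ b →
      ∃ z ∈ Metric.closedBall x a, dist y z ≤ b - a := by
    intro a b ha y hy hab
    rw [Metric.mem_closedBall, dist_comm] at hy
    rcases le_total (dist x y) a with h | h
    · exact ⟨y, by rwa [Metric.mem_closedBall, dist_comm], by rw [dist_self]; linarith⟩
    · obtain ⟨z, h1, h2⟩ := hX.exists_between x y ha h
      exact ⟨z, by rw [Metric.mem_closedBall, dist_comm, h1],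
        by rw [dist_comm, h2]; linarith⟩
  -- Every point of the ball of radius `R` is within `ε / 2` of a compact smaller ball, so the ball
  -- is totally bounded. A compact thickening of it then contradicts the choice of `R` as supremum.
  have hRS : R ∈ S := by
    rcases eq_or_lt_of_le hR0 with h | h
    · rwa [← h]
    refine TotallyBounded.isCompact_of_isClosed ?_ Metric.isClosed_closedBall
    rw [Metric.totallyBounded_iff]
    intro ε hε
    obtain ⟨a, haS, ha⟩ := exists_lt_of_lt_csSup ⟨0, h0⟩
      (show max 0 (R - ε / 2) < sSup S from max_lt h (by linarith))
    obtain ⟨t, ht, hcov⟩ := Metric.totallyBounded_iff.1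
      (show IsCompact (Metric.closedBall x a) from haS).totallyBounded (ε / 2) (by positivity)
    refine ⟨t, ht, fun y hy => ?_⟩
    obtain ⟨z, hz, hyz⟩ := hnear a R ((le_max_left _ _).trans ha.le) y hy (le_csSup hbdd haS)
    have := hcov hz
    simp only [Set.mem_iUnion, Metric.mem_ball] at this ⊢
    obtain ⟨c, hc, hzc⟩ := this
    refine ⟨c, hc, (dist_triangle y z c).trans_lt ?_⟩
    have : R - ε / 2 < a := (le_max_right _ _).trans_lt ha
    linarith
  obtain ⟨δ, hδ, hcomp⟩ := IsCompact.exists_isCompact_cthickening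
    (show IsCompact (Metric.closedBall x R) from hRS)
  have : R + δ ∈ S := by
    refine hcomp.of_isClosed_subset Metric.isClosed_closedBall fun y hy => ?_
    obtain ⟨z, hz, hyz⟩ := hnear R (R + δ) hR0 y hy (by linarith)
    exact Metric.mem_cthickening_of_dist_le y z δ _ hz (by linarith)
  linarith [le_csSup hbdd this]

/-! ### Two independent rank one isometries. -/

section IndependentAxes

variable {X : Type*} [MetricSpace X]

theorem IsHadamardSpace.exists_line_of_between (hX : IsHadamardSpace X) {σ : ℝ → X}
    (hσ : Isometry σ) {s t : ℝ} {w : X}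
    (hw : dist (σ s) w + dist w (σ t) = dist (σ s) (σ t)) : ∃ u, σ u = w := by
  have hle : dist (σ s) w ≤ |s - t| := by
    rw [← hσ.dist_line, ← hw]; linarith [@dist_nonneg _ _ w (σ t)]
  have h0 : 0 ≤ dist (σ s) w := dist_nonneg
  obtain ⟨u, hu1, hu2⟩ : ∃ u, |s - u| = dist (σ s) w ∧ |s - u| + |u - t| = |s - t| := by
    rcases le_total s t with h | h
    · rw [abs_of_nonpos (by linarith)] at hle ⊢
      refine ⟨s + dist (σ s) w, ?_, ?_⟩
      · rw [abs_of_nonpos (by linarith)]; ring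
      · rw [abs_of_nonpos (by linarith), abs_of_nonpos (by linarith)]; ring
    · rw [abs_of_nonneg (by linarith)] at hle ⊢
      refine ⟨s - dist (σ s) w, ?_, ?_⟩
      · rw [abs_of_nonneg (by linarith)]; ring
      · rw [abs_of_nonneg (by linarith), abs_of_nonneg (by linarith)]; ring
  refine ⟨u, dist_eq_zero.1 ?_⟩
  rw [hX.dist_between_between (x := σ s) (y := σ t) (m := σ u) (n := w)
    (by rw [hσ.dist_line, hσ.dist_line, hσ.dist_line, hu2]) hw, hσ.dist_line, hu1, sub_self,
    abs_zero]

/-- The axis of an isometry independent of a contracting one has bounded projection. -/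
theorem IsAxis.exists_abs_lineProj_sub_le (hX : IsHadamardSpace X) {g h : X ≃ᵢ X} {lg lh : ℝ}
    {σ τ : ℝ → X} (hσ : IsAxis g lg σ) (hτ : IsAxis h lh τ) (hgh : IndependentIsometries g h)
    {D : ℝ} (hD : ∀ x y, D ≤ |lineProj σ x - lineProj σ y| →
      ∃ z, dist x z + dist z y = dist x y ∧ dist z (σ (lineProj σ x)) ≤ D) :
    ∃ C, 0 ≤ C ∧ ∀ s, |lineProj σ (τ s) - lineProj σ (τ 0)| ≤ C := by
  have hlg := hσ.length_pos
  have hlh := hτ.length_pos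
  set x₀ := τ 0 with hx₀
  set e := dist (σ (lineProj σ x₀)) x₀ with he
  set R := D + lh + e with hR
  have hfin : {p : ℤ × ℤ | dist ((g ^ p.1) x₀) ((h ^ p.2) x₀) ∈ Set.Icc 0 R}.Finite :=
    ((hgh x₀).isCompact_preimage isCompact_Icc).finite_of_discrete
  obtain ⟨M, hM⟩ := (hfin.image fun p => p.1.natAbs).bddAbove
  obtain ⟨m₁, hm₁⟩ := exists_nat_ge (D / lg)
  set m := max (M + 1) m₁ with hm
  have hmD : D ≤ m * lg := by
    rw [div_le_iff₀ hlg] at hm₁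
    refine hm₁.trans (mul_le_mul_of_nonneg_right ?_ hlg.le)
    exact_mod_cast le_max_right _ _
  -- Otherwise some `τ t` has its foot shifted by exactly `k * lg` with `|k| = m`. Contraction then
  -- puts a point of `τ` within `D` of that foot, so `g ^ k x₀` is within `R` of the `h`-orbit of
  -- `x₀`; by independence this occurs only for `|k| ≤ M`.
  refine ⟨m * lg, by positivity, fun s => ?_⟩
  by_contra! hs
  obtain ⟨k, hkm, hk⟩ : ∃ k : ℤ, k.natAbs = m ∧
      (k : ℝ) * lg ∈ Set.uIcc 0 (lineProj σ (τ s) - lineProj σ x₀) := by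
    have hm0 : (0 : ℝ) ≤ m * lg := by positivity
    rcases le_total 0 (lineProj σ (τ s) - lineProj σ x₀) with h | h
    · rw [abs_of_nonneg h] at hs
      refine ⟨m, by simp, ?_⟩
      rw [Set.uIcc_of_le h]
      exact ⟨by simpa using hm0, by simpa using hs.le⟩
    · rw [abs_of_nonpos h] at hs
      refine ⟨-m, by simp, ?_⟩
      rw [Set.uIcc_of_ge h]
      push_cast
      constructor <;> linarith
  have hcont : Continuous fun t => lineProj σ (τ t) - lineProj σ x₀ :=
    ((hX.continuous_lineProj hσ.geodesic).comp hτ.geodesic.continuous).sub continuous_const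
  obtain ⟨t, -, ht⟩ := intermediate_value_uIcc (a := 0) (b := s) hcont.continuousOn
    (by simpa only [← hx₀, sub_self] using hk)
  simp only at ht
  have hkabs : |(k : ℝ)| = m := by rw [← hkm, Nat.cast_natAbs, Int.cast_abs]
  obtain ⟨w, hw, hwd⟩ := hD (τ t) x₀ (by rw [ht, abs_mul, hkabs, abs_of_pos hlg]; exact hmD)
  obtain ⟨u, rfl⟩ := hX.exists_line_of_between hτ.geodesic hw
  have d1 : dist ((h ^ ⌊u / lh⌋) x₀) (τ u) ≤ lh := by
    rw [hx₀, hτ.zpow_apply, hτ.geodesic.dist_line, zero_add]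
    have h1 := Int.floor_le (u / lh)
    have h2 := Int.lt_floor_add_one (u / lh)
    rw [le_div_iff₀ hlh] at h1
    rw [div_lt_iff₀ hlh] at h2
    rw [abs_of_nonpos (by linarith)]
    linarith
  have d2 : dist (σ (lineProj σ (τ t))) ((g ^ k) x₀) = e := by
    rw [show lineProj σ (τ t) = lineProj σ x₀ + k * lg by linarith, ← hσ.zpow_apply,
      IsometryEquiv.dist_eq]
  have hmem : (k, ⌊u / lh⌋) ∈ {p : ℤ × ℤ | dist ((g ^ p.1) x₀) ((h ^ p.2) x₀) ∈ Set.Icc 0 R} := by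
    refine ⟨dist_nonneg, ?_⟩
    have := dist_triangle4 ((g ^ k) x₀) (σ (lineProj σ (τ t))) (τ u) ((h ^ ⌊u / lh⌋) x₀)
    rw [dist_comm _ (σ (lineProj σ (τ t))), d2] at this
    rw [dist_comm] at hwd d1
    simp only
    linarith
  have : k.natAbs ≤ M := hM ⟨_, hmem, rfl⟩
  have : M + 1 ≤ m := le_max_left _ _
  omega

/-- If the foot of `x` on the axis `σ` is far from the projection of the line `τ`, then the foot
of `x` on `τ` is close to `τ 0`. -/
theorem IsHadamardSpace.abs_lineProj_le_of_far (hX : IsHadamardSpace X) {σ τ : ℝ → X}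
    (hσ : Isometry σ) (hτ : Isometry τ) {C D : ℝ}
    (hC : ∀ s, |lineProj σ (τ s) - lineProj σ (τ 0)| ≤ C)
    (hD : ∀ x y, D ≤ |lineProj σ x - lineProj σ y| →
      ∃ z, dist x z + dist z y = dist x y ∧ dist z (σ (lineProj σ x)) ≤ D)
    {x : X} (hx : C + D ≤ |lineProj σ x - lineProj σ (τ 0)|) :
    |lineProj τ x| ≤ D + C + dist (σ (lineProj σ (τ 0))) (τ 0) := by
  set a := lineProj τ x with ha
  have h1 : D ≤ |lineProj σ (τ a) - lineProj σ x| := by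
    have := abs_sub_le (lineProj σ x) (lineProj σ (τ a)) (lineProj σ (τ 0))
    rw [abs_sub_comm (lineProj σ x) (lineProj σ (τ a))] at this
    linarith [hC a]
  -- The geodesic from `τ a` to `x` leaves near the foot of `τ a` on `σ`, at a point `w` close to `τ
  -- 0`. As `w` lies between `x` and its foot on `τ`, it has the same foot there.
  obtain ⟨w, hw, hwd⟩ := hD _ _ h1
  have h2 : lineProj τ w = a := hX.lineProj_of_between hτ (x := x) (by
    rw [← ha, dist_comm x w, dist_comm w (τ a), dist_comm x (τ a), add_comm]
    exact hw)
  have h3 := hX.abs_lineProj_sub_le hτ w (τ 0)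
  rw [h2, hX.lineProj_line hτ, sub_zero] at h3
  have h4 := dist_triangle4 w (σ (lineProj σ (τ a))) (σ (lineProj σ (τ 0))) (τ 0)
  rw [hσ.dist_line] at h4
  linarith [hC a]

theorem IsRankOne.exists_contracting_axis [LocallyCompactSpace X] (hX : IsHadamardSpace X)
    {g : X ≃ᵢ X} (hg : IsRankOne g) : ∃ (l : ℝ) (σ : ℝ → X) (D : ℝ), IsAxis g l σ ∧ 0 < D ∧
      ∀ x y, D ≤ |lineProj σ x - lineProj σ y| →
        ∃ z, dist x z + dist z y = dist x y ∧ dist z (σ (lineProj σ x)) ≤ D := by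
  have := hX.properSpace
  obtain ⟨l, σ, hσ, hn⟩ := hg
  obtain ⟨T, δ, hT, hδ, hgap⟩ := hσ.exists_gap hX hn
  obtain ⟨D, hD, h⟩ := hX.exists_contraction hσ.geodesic hT hδ hgap
  exact ⟨l, σ, D, hσ, hD, h⟩

/-- For independent rank one isometries `g`, `h`, the conjugate `gⁿ hᵐ g⁻ⁿ` connects `x` and `y`
through a neighbourhood of `o`, unless `n` is close to the position of `x` or `y` along the axis
of `g`. -/
theorem IsRankOne.exists_connecting [LocallyCompactSpace X] (hX : IsHadamardSpace X)
    {g h : X ≃ᵢ X} (hg : IsRankOne g) (hh : IsRankOne h) (hgh : IndependentIsometries g h)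
    (o : X) : ∃ (s : X → ℝ) (W : ℝ) (m₀ : ℕ) (C : ℤ → ℝ), ∀ m ≥ m₀, ∀ (n : ℤ) (x y : X),
      W ≤ |s x - n| → W ≤ |s y - n| →
        ∃ w, dist x w + dist w ((g ^ n * h ^ m * (g ^ n)⁻¹) y)
          = dist x ((g ^ n * h ^ m * (g ^ n)⁻¹) y) ∧ dist w o ≤ C n := by
  obtain ⟨lg, σ, D, hσ, hD0, hD⟩ := hg.exists_contracting_axis hX
  obtain ⟨lh, τ, D', hτ, hD0', hD'⟩ := hh.exists_contracting_axis hX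
  obtain ⟨C, hC0, hC⟩ := hσ.exists_abs_lineProj_sub_le hX hτ hgh hD
  set E := D + C + dist (σ (lineProj σ (τ 0))) (τ 0) with hE
  have hlg := hσ.length_pos
  have hlh := hτ.length_pos
  obtain ⟨m₀, hm₀⟩ := exists_nat_ge ((2 * E + D') / lh)
  refine ⟨fun x => (lineProj σ x - lineProj σ (τ 0)) / lg, (C + D) / lg, m₀,
    fun n => D' + E + dist ((g ^ n) (τ 0)) o, fun m hm n x y hx hy => ?_⟩
  have hfoot : ∀ x, (C + D) / lg ≤ |(lineProj σ x - lineProj σ (τ 0)) / lg - n| →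
      |lineProj τ ((g ^ (-n)) x)| ≤ E := by
    intro x hx
    refine hX.abs_lineProj_le_of_far hσ.geodesic hτ.geodesic hC hD ?_
    rw [hσ.lineProj_zpow hX, show lineProj σ x + ((-n : ℤ) : ℝ) * lg - lineProj σ (τ 0)
      = ((lineProj σ x - lineProj σ (τ 0)) / lg - n) * lg by push_cast; field_simp; ring,
      abs_mul, abs_of_pos hlg]
    rwa [div_le_iff₀ hlg] at hx
  have fx := hfoot x hx
  have fy := hfoot y hy
  set x' := (g ^ (-n)) x with hx'
  set y' := (g ^ (-n)) y with hy'
  have hgx : (g ^ n) x' = x := by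
    rw [hx', ← IsometryEquiv.mul_apply, zpow_neg, mul_inv_cancel]; rfl
  have hγ : (g ^ n * h ^ m * (g ^ n)⁻¹) y = (g ^ n) ((h ^ m) y') := by
    rw [IsometryEquiv.mul_apply, IsometryEquiv.mul_apply, hy', zpow_neg]
  have hpy : lineProj τ ((h ^ m) y') = lineProj τ y' + m * lh := by
    have := hτ.lineProj_zpow hX m y'
    simpa using this
  have hmE : 2 * E + D' ≤ m * lh := by
    rw [div_le_iff₀ hlh] at hm₀
    refine hm₀.trans (mul_le_mul_of_nonneg_right ?_ hlh.le)
    exact_mod_cast hm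
  rw [abs_le] at fx fy
  -- The feet of `x'` and `y'` on `τ` lie in `[-E, E]`, and `h ^ m` shifts by at least `2 * E + D'`,
  -- so the feet of `x'` and `h ^ m y'` are at least `D'` apart.
  obtain ⟨w, hw, hwd⟩ := hD' x' ((h ^ m) y') (by
    rw [hpy, abs_sub_comm]
    exact le_trans (by linarith) (le_abs_self _))
  refine ⟨(g ^ n) w, ?_, ?_⟩
  · rw [hγ, ← hgx, IsometryEquiv.dist_eq, IsometryEquiv.dist_eq, IsometryEquiv.dist_eq, hw]
  · have h1 := dist_triangle ((g ^ n) w) ((g ^ n) (τ 0)) o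
    rw [IsometryEquiv.dist_eq] at h1
    have h2 := dist_triangle w (τ (lineProj τ x')) (τ 0)
    rw [hτ.geodesic.dist_line, sub_zero] at h2
    have := abs_le.2 fx
    linarith

end IndependentAxes

/-! ### Connecting elements in the product and their consequences. -/

section Product

variable {r : ℕ} {X : Fin r → Type*} [∀ i, MetricSpace (X i)]

/-- Finitely many elements of a group containing independent regular axial elements suffice to
connect any two points through a neighbourhood of the base point in all factors at once. -/
theorem exists_connecting_family [∀ i, LocallyCompactSpace (X i)]
    (hX : ∀ i, IsHadamardSpace (X i)) (Γ : Subgroup (∀ i, X i ≃ᵢ X i))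
    {g h : ∀ i, X i ≃ᵢ X i} (hgΓ : g ∈ Γ) (hhΓ : h ∈ Γ)
    (hg : IsRegularAxial g) (hh : IsRegularAxial h)
    (hgh : ∀ i, IndependentIsometries (g i) (h i)) (o : ∀ i, X i) :
    ∃ (γ : Fin (2 * r + 1) → Γ) (C : ℝ), 0 ≤ C ∧ ∀ x y : ∀ i, X i, ∃ j, ∀ i, ∃ w,
      dist (x i) w + dist w ((γ j).1 i (y i)) = dist (x i) ((γ j).1 i (y i)) ∧
        dist w (o i) ≤ C := by
  choose s W m₀ C hC using fun i => (hg i).exists_connecting (hX i) (hh i) (hgh i) (o i)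
  obtain ⟨B, hB⟩ := (Set.finite_range fun i => 2 * W i).bddAbove
  obtain ⟨N, hN⟩ := exists_nat_gt (max B 0)
  set m := Finset.univ.sup m₀ with hm
  set n : Fin (2 * r + 1) → ℤ := fun j => N * (j : ℕ) with hn
  obtain ⟨C', hC'⟩ := (Set.finite_range fun p : Fin r × Fin (2 * r + 1) => C p.1 (n p.2)).bddAbove
  refine ⟨fun j => ⟨g ^ n j * h ^ m * (g ^ n j)⁻¹, Γ.mul_mem (Γ.mul_mem (Γ.zpow_mem hgΓ _)
    (Γ.pow_mem hhΓ _)) (Γ.inv_mem (Γ.zpow_mem hgΓ _))⟩, max C' 0, le_max_right _ _,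
    fun x y => ?_⟩
  obtain ⟨j, hj⟩ : ∃ j, ∀ i, W i ≤ |s i (x i) - n j| ∧ W i ≤ |s i (y i) - n j| := by
    by_contra! hcon
    -- Pigeonhole: each of the `2 * r` positions excludes at most one `j`, because distinct `n j`
    -- differ by at least `N > 2 * W i`.
    have hbad : ∀ j, ∃ p : Fin r × Bool, |s p.1 (if p.2 then x p.1 else y p.1) - n j| < W p.1 := by
      intro j
      obtain ⟨i, hi⟩ := hcon j
      by_cases hxi : W i ≤ |s i (x i) - n j|
      · exact ⟨(i, false), by simpa using hi hxi⟩
      · exact ⟨(i, true), by simpa using hxi⟩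
    choose p hp using hbad
    have hinj : Function.Injective p := by
      intro j k hjk
      have h1 := hp j
      have h2 := hp k
      rw [← hjk] at h2
      have h3 : 2 * W (p j).1 ≤ B := hB ⟨(p j).1, rfl⟩
      have h4 : B < N := (le_max_left _ _).trans_lt hN
      have h0 : (0 : ℝ) < N := (le_max_right _ _).trans_lt hN
      have h5 : |(n j : ℝ) - n k| < N := by
        set q := s (p j).1 (if (p j).2 then x (p j).1 else y (p j).1)
        have := abs_sub_le (n j : ℝ) q (n k)
        rw [abs_sub_comm (n j : ℝ) q] at this
        linarith
      simp only [hn] at h5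
      push_cast at h5
      rw [← mul_sub, abs_mul, abs_of_pos h0, mul_lt_iff_lt_one_right h0] at h5
      have h6 : |((j : ℕ) : ℤ) - ((k : ℕ) : ℤ)| < 1 := by exact_mod_cast h5
      rw [Int.abs_lt_one_iff] at h6
      exact Fin.ext (by omega)
    have := Fintype.card_le_of_injective p hinj
    simp at this
    omega
  refine ⟨j, fun i => ?_⟩
  obtain ⟨w, hw, hwo⟩ := hC i m (Finset.le_sup (Finset.mem_univ i)) (n j) (x i) (y i)
    (hj i).1 (hj i).2
  exact ⟨w, hw, hwo.trans ((hC' ⟨(i, j), rfl⟩).trans (le_max_left _ _))⟩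

theorem IsDiscreteGroup.finite_setOf_dist_le [∀ i, ProperSpace (X i)]
    {Γ : Subgroup (∀ i, X i ≃ᵢ X i)} (hΓ : IsDiscreteGroup Γ) (o : ∀ i, X i) (R : ℝ) :
    {γ : Γ | ∀ i, dist (o i) (γ.1 i (o i)) ≤ R}.Finite := by
  have hK : IsCompact (Set.univ.pi fun i => Metric.closedBall (o i) (max R 0)) :=
    isCompact_univ_pi fun i => isCompact_closedBall _ _
  refine ((hΓ _ hK).preimage Subtype.val_injective.injOn).subset fun γ hγ => ⟨γ.2, ?_⟩
  refine ⟨fun i => γ.1 i (o i), ⟨o, fun i _ => ?_, rfl⟩, fun i _ => ?_⟩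
  · simp
  · rw [Metric.mem_closedBall, dist_comm]
    exact (hγ i).trans (le_max_left _ _)

/-- Applying `φ⁻¹` turns the displacement of `o` into the length of a geodesic through `w`.
Replacing `w` by `o` costs `2 * C`, and dropping `ψ` costs its own displacement. -/
theorem abs_dist_mul_sub_le {Y : Type*} [MetricSpace Y] {φ ψ χ : Y ≃ᵢ Y} {o w : Y} {C : ℝ}
    (hw : dist (φ⁻¹ o) w + dist w (ψ (χ o)) = dist (φ⁻¹ o) (ψ (χ o))) (hwo : dist w o ≤ C) :
    |dist o ((φ * ψ * χ) o) - dist o (φ o) - dist o (χ o)| ≤ 2 * C + dist o (ψ o) := by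
  have hφ : φ (φ⁻¹ o) = o := by rw [← IsometryEquiv.mul_apply, mul_inv_cancel]; rfl
  have e1 : dist o ((φ * ψ * χ) o) = dist (φ⁻¹ o) (ψ (χ o)) := by
    rw [← φ.dist_eq (φ⁻¹ o), hφ]; rfl
  have e2 : dist o (φ o) = dist (φ⁻¹ o) o := by rw [← φ.dist_eq (φ⁻¹ o), hφ]
  have e3 : dist o (χ o) = dist (ψ o) (ψ (χ o)) := (ψ.dist_eq _ _).symm
  rw [e1, e2, e3, ← hw, abs_le]
  have t1 := dist_triangle (φ⁻¹ o) w o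
  have t2 := dist_triangle_right (φ⁻¹ o) w o
  have t3 := dist_triangle w o (ψ (χ o))
  have t4 := dist_triangle_left o (ψ (χ o)) w
  have t5 := dist_triangle o (ψ o) (ψ (χ o))
  have t6 := dist_triangle_left (ψ o) (ψ (χ o)) o
  constructor <;> linarith

/-- Both `φ w` and `φ' w'` lie between `o` and the same endpoint, so by uniqueness of geodesics
their distance is the difference of their distances to `o`, at most `2 * C + t`. They are within `C`
of `φ o` and `φ' o` respectively. -/
theorem IsHadamardSpace.dist_le_of_mul_eq {Y : Type*} [MetricSpace Y] (hY : IsHadamardSpace Y)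
    {φ ψ χ φ' ψ' χ' : Y ≃ᵢ Y} {o w w' : Y} {C t : ℝ}
    (hw : dist (φ⁻¹ o) w + dist w (ψ (χ o)) = dist (φ⁻¹ o) (ψ (χ o))) (hwo : dist w o ≤ C)
    (hw' : dist (φ'⁻¹ o) w' + dist w' (ψ' (χ' o)) = dist (φ'⁻¹ o) (ψ' (χ' o)))
    (hwo' : dist w' o ≤ C) (heq : φ * ψ * χ = φ' * ψ' * χ')
    (ht : |dist o (φ o) - dist o (φ' o)| ≤ t) : dist (φ o) (φ' o) ≤ 4 * C + t := by
  have hinv : ∀ φ : Y ≃ᵢ Y, φ (φ⁻¹ o) = o := fun φ => by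
    rw [← IsometryEquiv.mul_apply, mul_inv_cancel]; rfl
  rw [← φ.dist_eq, ← φ.dist_eq w, ← φ.dist_eq (φ⁻¹ o) (ψ (χ o)), hinv] at hw
  rw [← φ'.dist_eq, ← φ'.dist_eq w', ← φ'.dist_eq (φ'⁻¹ o) (ψ' (χ' o)), hinv] at hw'
  rw [← φ.dist_eq] at hwo
  rw [← φ'.dist_eq] at hwo'
  have hp : φ (ψ (χ o)) = φ' (ψ' (χ' o)) := congrArg (fun f : Y ≃ᵢ Y => f o) heq
  rw [← hp] at hw'
  have key := hY.dist_between_between hw hw'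
  rw [abs_le] at ht
  have t1 := dist_triangle o (φ w) (φ o)
  have t2 := dist_triangle_right o (φ w) (φ o)
  have t3 := dist_triangle o (φ' w') (φ' o)
  have t4 := dist_triangle_right o (φ' w') (φ' o)
  have t5 : |dist o (φ w) - dist o (φ' w')| ≤ 2 * C + t := by
    rw [abs_le]; constructor <;> linarith
  have t6 := dist_triangle4 (φ o) (φ w) (φ' w') (φ' o)
  rw [dist_comm (φ o) (φ w)] at t6
  linarith

end Product

/-! ### Construction of the map and proof of both properties. -/

theorem proposition4p7 {r : ℕ} {X : Fin r → Type*} [∀ i, MetricSpace (X i)]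
    [∀ i, LocallyCompactSpace (X i)] (hX : ∀ i, IsHadamardSpace (X i))
    (Γ : Subgroup (∀ i, X i ≃ᵢ X i)) (hΓ : IsDiscreteGroup Γ)
    (g h : ∀ i, X i ≃ᵢ X i) (hgΓ : g ∈ Γ) (hhΓ : h ∈ Γ)
    (hg : IsRegularAxial g) (hh : IsRegularAxial h)
    (hgh : ∀ i, IndependentIsometries (g i) (h i))
    (o : ∀ i, X i) (ho : ∀ i, o i ∈ axisSet (h i)) :
    ∃ π : Γ × Γ → Γ,
      (∃ κ : ℝ, 0 ≤ κ ∧ ∀ α β : Γ,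
        ‖orbitVector o (π (α, β)).1 - orbitVector o α.1 - orbitVector o β.1‖ ≤ κ) ∧
      (∀ t : ℝ, 0 < t → ∃ Λ : Finset Γ, ∀ α β α' β' : Γ,
        ‖orbitVector o α.1 - orbitVector o α'.1‖ ≤ t →
        ‖orbitVector o β.1 - orbitVector o β'.1‖ ≤ t →
        π (α, β) = π (α', β') →
          (∃ μ ∈ Λ, α' = α * μ) ∧ (∃ μ ∈ Λ, β' = μ * β)) := by
  have := fun i => (hX i).properSpace
  obtain ⟨γ, C, hC0, hγ⟩ := exists_connecting_family hX Γ hgΓ hhΓ hg hh hgh o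
  choose j w hw hwo using fun p : Γ × Γ =>
    (hγ (fun i => (p.1.1 i)⁻¹ (o i)) (fun i => p.2.1 i (o i))).imp fun j hj =>
      (Classical.skolem.1 hj).imp fun w hw => And.intro (fun i => (hw i).1) (fun i => (hw i).2)
  obtain ⟨B, hB⟩ := (Set.finite_range fun p : Fin r × Fin (2 * r + 1) =>
    dist (o p.1) ((γ p.2).1 p.1 (o p.1))).bddAbove
  have hB : ∀ i j, dist (o i) ((γ j).1 i (o i)) ≤ max B 0 := fun i j =>
    (hB ⟨(i, j), rfl⟩).trans (le_max_left _ _)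
  set B' := max B 0
  refine ⟨fun p => p.1 * γ (j p) * p.2, ⟨√(∑ _i : Fin r, (2 * C + B') ^ 2), Real.sqrt_nonneg _,
    fun α β => ?_⟩, fun t ht => ?_⟩
  · rw [EuclideanSpace.norm_eq]
    refine Real.sqrt_le_sqrt (Finset.sum_le_sum fun i _ => pow_le_pow_left₀ (norm_nonneg _) ?_ 2)
    exact (abs_dist_mul_sub_le (hw (α, β) i) (hwo (α, β) i)).trans
      (by linarith [hB i (j (α, β))])
  -- `4 * C + t` bounds the displacement of `o` by `α⁻¹ * α'`; the two connecting elements that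
  -- enter `β' * β⁻¹` add at most `B'` each.
  · set R := 4 * C + t + 2 * B' with hR
    have hB0 : 0 ≤ B' := le_max_right _ _
    have hcoord : ∀ (α α' : Γ) (i : Fin r), ‖orbitVector o α.1 - orbitVector o α'.1‖ ≤ t →
        |dist (o i) (α.1 i (o i)) - dist (o i) (α'.1 i (o i))| ≤ t := fun α α' i h =>
      (PiLp.norm_apply_le (orbitVector o α.1 - orbitVector o α'.1) i).trans h
    refine ⟨(hΓ.finite_setOf_dist_le o R).toFinset, fun α β α' β' hα _ heq => ?_⟩
    have hμ : ∀ i, dist (o i) ((α⁻¹ * α').1 i (o i)) ≤ 4 * C + t := by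
      intro i
      have := (hX i).dist_le_of_mul_eq (hw (α, β) i) (hwo (α, β) i) (hw (α', β') i)
        (hwo (α', β') i) (congrFun (congrArg Subtype.val heq) i) (hcoord α α' i hα)
      rw [← (α⁻¹.1 i).dist_eq] at this
      have e : (α⁻¹.1 i) (α.1 i (o i)) = o i := by
        change ((α.1 i)⁻¹ * α.1 i) (o i) = o i
        rw [inv_mul_cancel]; rfl
      rw [e] at this
      exact this
    refine ⟨⟨α⁻¹ * α', ?_, by group⟩, ⟨β' * β⁻¹, ?_, by group⟩⟩
    · rw [Set.Finite.mem_toFinset]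
      exact fun i => (hμ i).trans (by linarith)
    · rw [Set.Finite.mem_toFinset]
      intro i
      set c := γ (j (α, β))
      set c' := γ (j (α', β'))
      have heq' : α * c * β = α' * c' * β' := heq
      have e : β' * β⁻¹ = c'⁻¹ * (α⁻¹ * α')⁻¹ * c := by
        have : β' = c'⁻¹ * α'⁻¹ * (α * c * β) := by rw [heq']; group
        rw [this]; group
      set μ := α⁻¹ * α'
      rw [e]
      -- Applying `μ * c'` turns the displacement of `o` by `c'⁻¹ * μ⁻¹ * c` into the distance from
      -- `μ c' o` to `c o`, which is at most the sum of the displacements by `c'`, `μ` and `c`.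
      have h1 : dist (c'.1 i (o i)) ((c' * (c'⁻¹ * μ⁻¹ * c)).1 i (o i))
          = dist (o i) ((c'⁻¹ * μ⁻¹ * c).1 i (o i)) := (c'.1 i).dist_eq _ _
      have h2 : dist ((μ * (c' * 1)).1 i (o i)) ((μ * (μ⁻¹ * c)).1 i (o i))
          = dist (c'.1 i (o i)) ((μ⁻¹ * c).1 i (o i)) := by
        rw [mul_one]
        exact (μ.1 i).dist_eq _ _
      have h3 : dist ((μ * c').1 i (o i)) (μ.1 i (o i)) = dist (c'.1 i (o i)) (o i) :=
        (μ.1 i).dist_eq _ _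
      rw [mul_one, mul_inv_cancel_left] at h2
      rw [mul_assoc, mul_inv_cancel_left, ← h2] at h1
      rw [mul_assoc, ← h1]
      have h4 := dist_triangle4 ((μ * c').1 i (o i)) (μ.1 i (o i)) (o i) (c.1 i (o i))
      rw [h3, dist_comm _ (o i), dist_comm _ (o i)] at h4
      have := hB i (j (α, β))
      have := hB i (j (α', β'))
      have := hμ i
      linarith
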